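/- Let $d\ge 0$, let $f:\mathbb{R}^d\to\mathbb{R}$ be differentiable with $\nabla f$ bounded and Lipschitz continuous on every compact set, and let $S=\{\theta:\nabla f(\theta)=0\}$. Let $\{\alpha_n\}_{n\ge0}$ be positive reals, $\theta_0$ an $\mathbb{R}^d$-valued random variable and $\{w_n\}_{n\ge0}$ an $\mathbb{R}^d$-valued stochastic process on a probability space $(\Omega,\mathcal F,P)$, and let $$\theta_{n+1}=\theta_n-\alpha_n(\nabla f(\theta_n)+w_n),\qquad n\ge 0.$$ Put $\gamma_0=0$, $\gamma_n=\sum_{i=0}^{n-1}\alpha_i$, $a(n,t)=\max\{k\ge n:\gamma_k-\gamma_n\le t\}$ and $\Lambda=\{\sup_n\|\theta_n\|<\infty\}$. Here $\|\cdot\|$ is the Euclidean norm and $d(\cdot,\cdot)$ the Euclidean distance. Assume: 1. $\alpha_n\to0$ and $\sum_n\alpha_n=\infty$. 2. For a fixed $r\in(0,\infty)$, $$w=\limsup_{n\to\infty}\max_{n\le k<a(n,1)}\Big\|\sum_{i=n}^k\alpha_i\gamma_i^r w_i\Big\|<\infty\quad\text{almost surely on }\Lambda.$$ 3. For every compact $Q\subset\mathbb{R}^d$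 and every $a\in f(Q)$ there are given $\delta_{Q,a}\in(0,1)$, $\mu_{Q,a}\in(1,2]$, $M_{Q,a}\in[1,\infty)$ such that $|f(\theta)-a|\le M_{Q,a}\|\nabla f(\theta)\|^{\mu_{Q,a}}$ for all $\theta\in Q$ with $|f(\theta)-a|\le\delta_{Q,a}$. For compact $Q$ let $C_Q\in[1,\infty)$ be an upper bound of $\|\nabla f\|$ on $Q$ and a Lipschitz constant of $\nabla f$ on $Q$. Let $\hat A$ be the (random) set of accumulation points of $\{\theta_n\}$, let $\hat f=\liminf_n f(\theta_n)$, and let $\rho>0$ be an arbitrary, possibly random, positive quantity. On $\Lambda$ put $\hat Q=\{\theta:d(\theta,\hat A)\le\rho\}$, $\hat\mu=\mu_{\hat Q,\hat f}$, $\hat C=C_{\hat Q}$, $\hat M=M_{\hat Q,\hat f}$; off $\Lambda$ put $\hat Q=\hat A$, $\hat\mu=2$, $\hat C=\hat M=1$. Let $\hat r=1/(2-\hat\mu)$ if $\hat\mu<2$ and $\hat r=\infty$ if $\hat\mu=2$, let $\hat p=\hat\mu\min\{r,\hat r\}$, and let $\phi(w)=w$ if $r<\hat r$, $\phi(w)=1+w$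 if $r=\hat r$, $\phi(w)=1$ if $r>\hat r$. Then there is a random quantity $\hat K\in[1,\infty)$ which is a deterministic function of $\hat C,\hat M$ (the function depends only on $r$) such that, almost surely on $\Lambda$, $$\limsup_{n\to\infty}\gamma_n^{\hat p}\|\nabla f(\theta_n)\|^2\le\hat K(\phi(w))^{\hat\mu},\qquad \limsup_{n\to\infty}\gamma_n^{\hat p}|f(\theta_n)-\hat f|\le\hat K(\phi(w))^{\hat\mu}.$$ Suppose in addition that 4. for every compact $Q\subset\mathbb{R}^d$ there are given $\nu_Q\in(0,1]$, $N_Q\in[1,\infty)$ such that $d(\theta,S)\le N_Q\|\nabla f(\theta)\|^{\nu_Q}$ for all $\theta\in Q$. Put $\hat\nu=\mu_{\hat Q,\hat f}\,\nu_{\hat Q}/2$, $\hat N=N_{\hat Q}$ on $\Lambda$ and $\hat\nu=\hat N=1$ off $\Lambda$, and let $\hat q=\hat\nu\min\{r,\hat r\}$. Then there is a random quantity $\hat L\in[1,\infty)$ which is a deterministic function of $\hat C,\hat M,\hat N$ (the function depends only on $r$) such that, almost surely on $\Lambda$, $$\limsup_{n\to\infty}\gamma_n^{\hat q}\,d(\theta_n,S)\le\hat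 L(\phi(w))^{\hat\nu}.$$ -/

import Mathlib

open MeasureTheory Filter Topology
open scoped ENNReal

universe u

namespace StochGrad

/-- `gam α n = α 0 + ... + α (n - 1)`, with `gam α 0 = 0`. -/
def gam (α : ℕ → ℝ) (n : ℕ) : ℝ := ∑ i ∈ Finset.range n, α i

/-- The index `a(n, t) = max {k ≥ n : γ_k - γ_n ≤ t}`.
The set is finite as soon as the step sizes are positive and have an infinite sum. -/
noncomputable def aIdx (α : ℕ → ℝ) (n : ℕ) (t : ℝ) : ℕ :=
  sSup {k : ℕ | n ≤ k ∧ gam α k - gam α n ≤ t}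

/-- Step sizes: `α_n > 0`, `α_n → 0`, and `∑ α_n = ∞` (that is, `γ_n → ∞`). -/
structure StepSizes (α : ℕ → ℝ) : Prop where
  pos : ∀ n, 0 < α n
  tendsto_zero : Tendsto α atTop (𝓝 0)
  sum_infinite : Tendsto (gam α) atTop atTop

section

variable {E : Type*} [NormedAddCommGroup E] [InnerProductSpace ℝ E]

/-- The noise level
`limsup_n max_{n ≤ k < a(n,1)} ‖∑_{i=n}^k α_i γ_i^r w_i‖` of a realization `w` of the noise,
as an element of `[0, ∞]` (a maximum over the empty set is `0`). -/
noncomputable def noiseLevel (α : ℕ → ℝ) (r : ℝ) (w : ℕ → E) : ℝ≥0∞ :=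
  limsup (fun n : ℕ =>
    (Finset.Ico n (aIdx α n 1)).sup fun k : ℕ =>
      ‖∑ i ∈ Finset.Icc n k, (α i * gam α i ^ r) • w i‖ₑ) atTop

/-- `sup_n ‖x_n‖ < ∞`. -/
def BoundedPath (x : ℕ → E) : Prop := BddAbove (Set.range fun n => ‖x n‖)

/-- The set of accumulation points of the sequence `x`. -/
def accSet (x : ℕ → E) : Set E := {y | MapClusterPt y atTop x}

/-- `liminf_n f(x_n)`. -/
noncomputable def fHat (f : E → ℝ) (x : ℕ → E) : ℝ := liminf (fun n => f (x n)) atTop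

open Classical in
/-- The closed `ρ`-neighbourhood of the accumulation set for a bounded sequence,
and the accumulation set itself otherwise. -/
noncomputable def QHat (x : ℕ → E) (ρ : ℝ) : Set E :=
  if BoundedPath x then {y | Metric.infDist y (accSet x) ≤ ρ} else accSet x

variable [CompleteSpace E]

/-- The stationary points of `f`. -/
def stationarySet (f : E → ℝ) : Set E := {x | gradient f x = 0}

/-- `C Q ∈ [1, ∞)` is an upper bound of `‖∇f‖` on `Q` and a Lipschitz constant of `∇f` on `Q`,
for every compact `Q`. -/
def GradientBounds (f : E → ℝ) (C : Set E → ℝ) : Prop :=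
  ∀ Q : Set E, IsCompact Q →
    1 ≤ C Q ∧ (∀ x ∈ Q, ‖gradient f x‖ ≤ C Q) ∧
      ∀ x ∈ Q, ∀ y ∈ Q, ‖gradient f x - gradient f y‖ ≤ C Q * ‖x - y‖

/-- The Lojasiewicz gradient inequality: for every compact `Q` and `a ∈ f(Q)`,
the numbers `δ Q a ∈ (0, 1)`, `μ Q a ∈ (1, 2]` and `M Q a ∈ [1, ∞)` satisfy
`|f(x) - a| ≤ M ‖∇f(x)‖ ^ μ` for all `x ∈ Q` with `|f(x) - a| ≤ δ`. -/
def LojasiewiczGradient (f : E → ℝ) (δ μ M : Set E → ℝ → ℝ) : Prop :=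
  ∀ Q : Set E, IsCompact Q → ∀ a ∈ f '' Q,
    (0 < δ Q a ∧ δ Q a < 1) ∧ (1 < μ Q a ∧ μ Q a ≤ 2) ∧ 1 ≤ M Q a ∧
      ∀ x ∈ Q, |f x - a| ≤ δ Q a → |f x - a| ≤ M Q a * ‖gradient f x‖ ^ μ Q a

/-- The Lojasiewicz distance inequality: for every compact `Q`, the numbers `ν Q ∈ (0, 1]` and
`N Q ∈ [1, ∞)` satisfy `d(x, S) ≤ N ‖∇f(x)‖ ^ ν` for all `x ∈ Q`. -/
def LojasiewiczDistance (f : E → ℝ) (ν N : Set E → ℝ) : Prop :=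
  ∀ Q : Set E, IsCompact Q →
    (0 < ν Q ∧ ν Q ≤ 1) ∧ 1 ≤ N Q ∧
      ∀ x ∈ Q, Metric.infDist x (stationarySet f) ≤ N Q * ‖gradient f x‖ ^ ν Q

end

section

variable {E : Type*} [NormedAddCommGroup E] [InnerProductSpace ℝ E]

open Classical in
noncomputable def muHat (f : E → ℝ) (μ : Set E → ℝ → ℝ) (x : ℕ → E) (ρ : ℝ) : ℝ :=
  if BoundedPath x then μ (QHat x ρ) (fHat f x) else 2

open Classical in
noncomputable def MHat (f : E → ℝ) (M : Set E → ℝ → ℝ) (x : ℕ → E) (ρ : ℝ) : ℝ :=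
  if BoundedPath x then M (QHat x ρ) (fHat f x) else 1

open Classical in
noncomputable def nuHat (f : E → ℝ) (μ : Set E → ℝ → ℝ) (ν : Set E → ℝ) (x : ℕ → E) (ρ : ℝ) : ℝ :=
  if BoundedPath x then μ (QHat x ρ) (fHat f x) * ν (QHat x ρ) / 2 else 1

open Classical in
noncomputable def CHat (C : Set E → ℝ) (x : ℕ → E) (ρ : ℝ) : ℝ :=
  if BoundedPath x then C (QHat x ρ) else 1

open Classical in
noncomputable def NHat (N : Set E → ℝ) (x : ℕ → E) (ρ : ℝ) : ℝ :=
  if BoundedPath x then N (QHat x ρ) else 1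

end

/-- `1 / (2 - m)` for `m < 2` and `∞` for `m = 2`. -/
noncomputable def rHat (m : ℝ) : EReal :=
  if m < 2 then ((1 / (2 - m) : ℝ) : EReal) else ⊤

/-- The exponent `c · min {r, rHat m}`; it is `p̂` for `c = m = μ̂`,
and `q̂` for `c = ν̂`, `m = μ̂`. -/
noncomputable def rateExp (r c m : ℝ) : ℝ := c * (min (r : EReal) (rHat m)).toReal

/-- `φ(w)`: `w` if `r < rHat m`, `1 + w` if `r = rHat m`, and `1` if `r > rHat m`. -/
noncomputable def phi (r m : ℝ) (w : ℝ≥0∞) : ℝ≥0∞ :=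
  if (r : EReal) < rHat m then w else if (r : EReal) = rHat m then 1 + w else 1

end StochGrad

open StochGrad

/-! The argument is pathwise and reduces to the scalar energy `u n = f (x n) - fHat f x` with slope
`g n = ‖gradient f (x n)‖`. Over a window of clock length between T/2 and T, with T of order 1/C,
the gradient changes little apart from a noise term, and Abel summation bounds the accumulated noise
by W γ^(-r). Hence u drops by c g² up to an error of order γ^(-2r) (`IsGradientPath.descent`). Since
the Lojasiewicz inequality gives g² ≥ (|u|/M)^(2/μ), u behaves like a solution of u' ≤ -c |u|^(2/μ)
+ γ^(-2r): it decays like γ^(-μ r) if the noise dominates, and like γ^(-μ/(2-μ)) if the intrinsic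
decay is slower.

This is made rigorous by comparison with a barrier Φ. Once u is below Φ it stays there at the ends
of consecutive windows, and within a factor 6 in between (`EventualDescent.exists_shift`). If u were
ever below -Φ late on, descent would keep it below a fixed negative number infinitely often,
contradicting u → 0 (`EventualDescent.neg_barrier_le`).

The comparison runs twice. Constant barriers, for which the lower bound is just the definition of
the lower limit, give u → 0 and g → 0. Windows then stay inside `QHat`, so the second run, with Φ =
B γ^(-p̂), involves only the constants of that set. The barrier starts at a path-dependent time, but
a shift of the clock does not change the limsup. Finally W decreases to the noise level. -/

namespace StochGrad

/-! ### Comparison of scalar energies with barriers -/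

/-- A scalar energy `u` with slope `g` along the clock `γ`: over suitable windows of length at
most `T` it drops by `c g²` up to an error `E`, it never rises by more than `c g² + E` inside a
window, and it satisfies a Lojasiewicz inequality at levels below `δ`. -/
structure EventualDescent (γ u g : ℕ → ℝ) (E : ℝ → ℝ) (T c δ M μ : ℝ) : Prop where
  step : ∀ᶠ n in atTop, ∃ m, n < m ∧ γ m - γ n ≤ T ∧ u m ≤ u n - c * g n ^ 2 + E (γ n)
  rise : ∀ᶠ n in atTop, ∀ m, n ≤ m → γ m - γ n ≤ T → u m ≤ u n + c * g n ^ 2 + E (γ n)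
  loja : ∀ᶠ n in atTop, |u n| ≤ δ → |u n| ≤ M * g n ^ μ

/-- A barrier for the levels of an energy as in `EventualDescent`. -/
structure IsBarrier (Φ E : ℝ → ℝ) (T c δ M μ G : ℝ) : Prop where
  pos : ∀ t, G ≤ t → 0 < Φ t
  le : ∀ t, G ≤ t → Φ t ≤ δ
  anti : AntitoneOn Φ (Set.Ici G)
  error_nonneg : ∀ t, G ≤ t → 0 ≤ E t
  error_anti : AntitoneOn E (Set.Ici G)
  half : ∀ t, G ≤ t → Φ t / 2 + E t ≤ Φ (t + T)
  drop : ∀ t, G ≤ t → Φ t - Φ (t + T) + E t ≤ c * (Φ t / (2 * M)) ^ (2 / μ)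

lemma rpow_two_div_le_sq {a M g μ : ℝ} (ha : 0 ≤ a) (hM : 0 < M) (hg : 0 ≤ g) (hμ : 0 < μ)
    (h : a ≤ M * g ^ μ) : (a / M) ^ (2 / μ) ≤ g ^ 2 := by
  have h1 : a / M ≤ g ^ μ := by rwa [div_le_iff₀' hM]
  calc (a / M) ^ (2 / μ) ≤ (g ^ μ) ^ (2 / μ) := by gcongr
    _ = g ^ (2 : ℝ) := by rw [← Real.rpow_mul hg]; congr 1; field_simp
    _ = g ^ 2 := by norm_num

section

variable {γ u g : ℕ → ℝ} {Φ E : ℝ → ℝ} {T c δ M μ G : ℝ}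

/-- Above half of the barrier the slope compensates for the error and for the barrier's decay. -/
lemma IsBarrier.drop_le (hΦ : IsBarrier Φ E T c δ M μ G) (hM : 0 < M) (hμ : 0 < μ) (hc : 0 < c)
    {t v s : ℝ} (ht : G ≤ t) (hs : 0 ≤ s) (hv : Φ t / 2 ≤ |v|) (hloja : |v| ≤ M * s ^ μ) :
    Φ t - Φ (t + T) + E t ≤ c * s ^ 2 := by
  refine (hΦ.drop t ht).trans ?_
  have h0 := hΦ.pos t ht
  have h1 := rpow_two_div_le_sq (by positivity) hM hs hμ (hv.trans hloja)
  rw [div_div] at h1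
  gcongr

/-- An energy tending to zero stays above minus the barrier. -/
lemma EventualDescent.neg_barrier_le (h : EventualDescent γ u g E T c δ M μ)
    (hΦ : IsBarrier Φ E T c δ M μ G) (hM : 0 < M) (hμ : 0 < μ) (hc : 0 < c) (hT : 0 ≤ T)
    (hδ : 0 < δ) (hg : ∀ n, 0 ≤ g n) (hγ : Monotone γ) (hγ' : Tendsto γ atTop atTop)
    (hu : Tendsto u atTop (𝓝 0)) : ∀ᶠ n in atTop, -Φ (γ n) ≤ u n := by
  have hδu : ∀ᶠ n in atTop, |u n| ≤ δ := by
    have := hu.abs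
    rw [abs_zero] at this
    exact (this.eventually_lt_const hδ).mono fun _ => le_of_lt
  obtain ⟨N, hN⟩ := eventually_atTop.1
    (h.step.and (h.loja.and (hδu.and (hγ'.eventually_ge_atTop G))))
  refine eventually_atTop.2 ⟨N, fun n hn => ?_⟩
  by_contra! hlt
  -- Below the barrier the slope outweighs the error, so passing from window to window the energy
  -- never exceeds `u n` again.
  have key : ∀ k, ∃ j, k ≤ j ∧ n ≤ j ∧ u j ≤ u n ∧ u j ≤ -Φ (γ j) := by
    intro k
    induction k with
    | zero => exact ⟨n, Nat.zero_le _, le_rfl, le_rfl, hlt.le⟩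
    | succ k ih =>
      obtain ⟨j, hkj, hnj, hj1, hj2⟩ := ih
      obtain ⟨⟨m, hjm, hmT, hm⟩, hl, hd, hG⟩ := hN j (hn.trans hnj)
      have hp := hΦ.pos _ hG
      have h1 : Φ (γ j) / 2 ≤ |u j| := by
        rw [abs_of_neg (by linarith)]; linarith
      have h2 := hΦ.drop_le hM hμ hc hG (hg j) h1 (hl hd)
      have h3 : Φ (γ j + T) ≤ Φ (γ j) :=
        hΦ.anti hG (show G ≤ γ j + T by linarith) (by linarith)
      have h4 : Φ (γ m) ≤ Φ (γ j) := hΦ.anti hG (hG.trans (hγ hjm.le)) (hγ hjm.le)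
      exact ⟨m, by omega, by omega, by linarith, by linarith⟩
  have hneg : u n < 0 := hlt.trans (neg_neg_of_pos (hΦ.pos _ (hN n hn).2.2.2))
  obtain ⟨N', hN'⟩ := eventually_atTop.1 (hu.eventually_const_lt hneg)
  obtain ⟨j, hj, -, hj1, -⟩ := key N'
  exact absurd (hN' j hj) (not_lt.2 hj1)

/-- An energy bounded below by minus the barrier and starting below it stays below a multiple
of the barrier run from a later time, and so does its squared slope. -/
lemma EventualDescent.exists_shift (h : EventualDescent γ u g E T c δ M μ)
    (hΦ : IsBarrier Φ E T c δ M μ G) (hM : 0 < M) (hμ : 0 < μ) (hc : 0 < c) (hT : 0 ≤ T)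
    (hg : ∀ n, 0 ≤ g n) (hγ : Monotone γ) (hγ' : Tendsto γ atTop atTop)
    (hlow : ∀ᶠ n in atTop, -Φ (γ n) ≤ u n) (hfreq : ∃ᶠ n in atTop, u n ≤ Φ G) :
    ∃ s, ∀ᶠ n in atTop, |u n| ≤ 6 * Φ (γ n - s) ∧ c * g n ^ 2 ≤ 14 * Φ (γ n - s) := by
  obtain ⟨N, hN⟩ := eventually_atTop.1
    (h.step.and (h.rise.and (h.loja.and (hlow.and (hγ'.eventually_ge_atTop G)))))
  obtain ⟨n₀, hn₀N, hn₀⟩ := (frequently_atTop.1 hfreq) N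
  -- This shift makes the barrier start from `Φ G` at the entry index `n₀`.
  set s := γ n₀ - G with hs
  have hs0 : 0 ≤ s := by have := (hN n₀ hn₀N).2.2.2.2; linarith
  have hGs : ∀ n, n₀ ≤ n → G ≤ γ n - s := fun n hn => by have := hγ hn; linarith
  have hlow' : ∀ n, n₀ ≤ n → -Φ (γ n - s) ≤ u n := fun n hn => by
    have h1 := (hN n (hn₀N.trans hn)).2.2.2.1
    have h2 : Φ (γ n) ≤ Φ (γ n - s) :=
      hΦ.anti (hGs n hn) (show G ≤ γ n by have := hGs n hn; linarith) (by linarith)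
    linarith
  have hE : ∀ n, n₀ ≤ n → E (γ n) ≤ E (γ n - s) := fun n hn =>
    hΦ.error_anti (hGs n hn) (show G ≤ γ n by have := hGs n hn; linarith) (by linarith)
  have hanti : ∀ n m, n₀ ≤ n → n ≤ m → γ m - γ n ≤ T → Φ (γ n - s + T) ≤ Φ (γ m - s) :=
    fun n m hn hnm hT' => hΦ.anti (hGs m (hn.trans hnm))
      (show G ≤ γ n - s + T by have := hGs n hn; linarith) (by linarith)
  have hnext : ∀ j, n₀ ≤ j → u j ≤ Φ (γ j - s) → ∃ m, j < m ∧ γ m - γ j ≤ T ∧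
      u m ≤ u j - c * g j ^ 2 + E (γ j) ∧ u m ≤ Φ (γ m - s) := by
    intro j hj huj
    obtain ⟨⟨m, hjm, hmT, hm⟩, -, hl, -, -⟩ := hN j (hn₀N.trans hj)
    refine ⟨m, hjm, hmT, hm, ?_⟩
    have h1 := hE j hj
    have h2 := hanti j m hj hjm.le hmT
    have hp := hΦ.pos _ (hGs j hj)
    -- In the upper half of the barrier the Lojasiewicz inequality forces enough slope; in the lower
    -- half, negative values included, `half` says that the error alone cannot lift the energy over
    -- the barrier.
    rcases le_or_gt (Φ (γ j - s) / 2) (u j) with hcase | hcase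
    · have habs : |u j| = u j := abs_of_pos (by linarith)
      have h3 := hΦ.drop_le hM hμ hc (hGs j hj) (hg j) (hcase.trans (le_abs_self _))
        (hl (by rw [habs]; exact huj.trans (hΦ.le _ (hGs j hj))))
      linarith
    · have h3 := hΦ.half _ (hGs j hj)
      have : 0 ≤ c * g j ^ 2 := by positivity
      linarith
  have hchain : ∀ n, n₀ ≤ n → ∃ j m, n₀ ≤ j ∧ j ≤ n ∧ n < m ∧ γ m - γ j ≤ T ∧ u j ≤ Φ (γ j - s) ∧
      u m ≤ u j - c * g j ^ 2 + E (γ j) ∧ u m ≤ Φ (γ m - s) := by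
    intro n hn
    induction n, hn using Nat.le_induction with
    | base =>
      have h0 : u n₀ ≤ Φ (γ n₀ - s) := by rw [hs, sub_sub_cancel]; exact hn₀
      obtain ⟨m, h1, h2, h3, h4⟩ := hnext n₀ le_rfl h0
      exact ⟨n₀, m, le_rfl, le_rfl, h1, h2, h0, h3, h4⟩
    | succ n hn ih =>
      obtain ⟨j, m, h1, h2, h3, h4, h5, h6, h7⟩ := ih
      rcases Nat.lt_or_ge (n + 1) m with hlt | hge
      · exact ⟨j, m, h1, by omega, hlt, h4, h5, h6, h7⟩
      · obtain rfl : m = n + 1 := by omega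
        obtain ⟨m', h1', h2', h3', h4'⟩ := hnext (n + 1) (by omega) h7
        exact ⟨n + 1, m', by omega, le_rfl, h1', h2', h7, h3', h4'⟩
  have hupper : ∀ n, n₀ ≤ n → |u n| ≤ 6 * Φ (γ n - s) := by
    intro n hn
    have hp := hΦ.pos _ (hGs n hn)
    refine abs_le.2 ⟨by have := hlow' n hn; linarith, ?_⟩
    -- The rise inside a window is paid for by its total drop: c g_j² ≤ u_j - u_m + E, so u_n ≤ 2u_j
    -- - u_m + 2E ≤ 3Φ + 2E with Φ, E taken at the start of the window. By `half` this is at most 6Φ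
    -- at n.
    obtain ⟨j, m, h1, h2, h3, h4, h5, h6, -⟩ := hchain n hn
    have hnT : γ n - γ j ≤ T := by have := hγ h3.le; linarith
    have h7 := (hN j (hn₀N.trans h1)).2.1 n h2 hnT
    have h8 := hlow' m (by omega)
    have h9 := hE j h1
    have h10 := hanti j n h1 h2 hnT
    have h11 := hΦ.half _ (hGs j h1)
    have h12 : Φ (γ m - s) ≤ Φ (γ j - s) := hΦ.anti (hGs j h1) (hGs m (by omega))
      (by have := hγ (show j ≤ m by omega); linarith)
    have h13 := hΦ.error_nonneg _ (hGs j h1)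
    linarith
  refine ⟨s, eventually_atTop.2 ⟨n₀, fun n hn => ⟨hupper n hn, ?_⟩⟩⟩
  obtain ⟨⟨m, hnm, hmT, hm⟩, -⟩ := hN n (hn₀N.trans hn)
  have h1 := (abs_le.1 (hupper n hn)).2
  have h2 := hlow' m (by omega)
  have h3 : Φ (γ m - s) ≤ Φ (γ n - s) := hΦ.anti (hGs n hn) (hGs m (by omega))
      (by have := hγ hnm.le; linarith)
  have h4 := hE n hn
  have h5 := hΦ.half _ (hGs n hn)
  have h6 : Φ (γ n - s + T) ≤ Φ (γ n - s) :=
    hΦ.anti (hGs n hn) (show G ≤ γ n - s + T by have := hGs n hn; linarith) (by linarith)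
  have h7 := hΦ.pos _ (hGs n hn)
  linarith

end

/-! ### The clock and its windows -/

section

variable {α : ℕ → ℝ}

lemma gam_sub {n m : ℕ} (h : n ≤ m) : gam α m - gam α n = ∑ i ∈ Finset.Ico n m, α i :=
  (Finset.sum_Ico_eq_sub α h).symm

lemma StepSizes.gam_mono (hα : StepSizes α) : Monotone (gam α) :=
  monotone_nat_of_le_succ fun n => by
    rw [gam, gam, Finset.sum_range_succ]; linarith [hα.pos n]

lemma StepSizes.le_aIdx (hα : StepSizes α) {n k : ℕ} {t : ℝ} (hnk : n ≤ k)
    (h : gam α k - gam α n ≤ t) : k ≤ aIdx α n t := by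
  -- The supremum of an unbounded set of naturals would be the default 0; divergence of the clock
  -- excludes this.
  obtain ⟨N, hN⟩ := eventually_atTop.1 (hα.sum_infinite.eventually_gt_atTop (gam α n + t))
  refine le_csSup ⟨N, fun j hj => ?_⟩ ⟨hnk, h⟩
  by_contra! hlt
  linarith [hN j hlt.le, hj.2]

/-- Windows with length between `T / 2` and `T` start at every late index. -/
lemma StepSizes.eventually_exists_window (hα : StepSizes α) {T : ℝ} (hT : 0 < T) :
    ∀ᶠ n in atTop, ∃ m, n < m ∧ T / 2 ≤ gam α m - gam α n ∧ gam α m - gam α n ≤ T := by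
  obtain ⟨N, hN⟩ := eventually_atTop.1 (hα.tendsto_zero.eventually_lt_const (half_pos hT))
  refine eventually_atTop.2 ⟨N, fun n hn => ?_⟩
  -- Take the first index reaching T/2: the last step is shorter than T/2, so the overshoot stays
  -- below T.
  have hex : ∃ m, T / 2 ≤ gam α m - gam α n := by
    obtain ⟨m, hm⟩ := (hα.sum_infinite.eventually_ge_atTop (gam α n + T / 2)).exists
    exact ⟨m, by linarith⟩
  classical
  have hspec := Nat.find_spec hex
  have hlt : n < Nat.find hex := by
    by_contra! hle
    linarith [hα.gam_mono hle]
  obtain ⟨k, hk⟩ : ∃ k, Nat.find hex = k + 1 := ⟨Nat.find hex - 1, by omega⟩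
  have hmin := Nat.find_min hex (m := k) (by omega)
  rw [hk] at hspec hlt
  refine ⟨k + 1, hlt, hspec, ?_⟩
  have h1 : gam α (k + 1) = gam α k + α k := Finset.sum_range_succ _ _
  have h2 := hN k (by omega)
  linarith

end

/-! ### Noise sums and descent along a gradient path -/

section

variable {E : Type*} [NormedAddCommGroup E] [InnerProductSpace ℝ E]

/-- Abel summation: antitone weights turn a bound on partial sums into a bound on the
weighted sum. -/
lemma norm_sum_smul_le_of_antitone {b : ℕ → ℝ} {v : ℕ → E} {n m : ℕ} {W : ℝ} (hnm : n ≤ m)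
    (hb : ∀ i, n ≤ i → b (i + 1) ≤ b i) (hb0 : ∀ i, n ≤ i → 0 ≤ b i)
    (hW : ∀ j, n ≤ j → j ≤ m → ‖∑ i ∈ Finset.Ico n j, v i‖ ≤ W) :
    ‖∑ i ∈ Finset.Ico n m, b i • v i‖ ≤ b n * W := by
  -- The difference is the sum of (b_i - b_{i+1}) times partial sums, and these nonnegative weights
  -- telescope to b_n - b_j.
  have key : ∀ j, n ≤ j → j ≤ m →
      ‖∑ i ∈ Finset.Ico n j, b i • v i - b j • ∑ i ∈ Finset.Ico n j, v i‖ ≤ (b n - b j) * W := by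
    intro j hj
    induction j, hj using Nat.le_induction with
    | base => simp
    | succ j hj ih =>
      intro hjm
      have h1 := ih (by omega)
      have h2 := hW (j + 1) (by omega) hjm
      have h3 : ∑ i ∈ Finset.Ico n (j + 1), b i • v i - b (j + 1) • ∑ i ∈ Finset.Ico n (j + 1), v i
          = (∑ i ∈ Finset.Ico n j, b i • v i - b j • ∑ i ∈ Finset.Ico n j, v i)
            + (b j - b (j + 1)) • ∑ i ∈ Finset.Ico n (j + 1), v i := by
        rw [Finset.sum_Ico_succ_top hj, Finset.sum_Ico_succ_top hj]
        module
      have hbj : 0 ≤ b j - b (j + 1) := sub_nonneg.2 (hb j hj)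
      rw [h3]
      refine (norm_add_le _ _).trans ?_
      rw [norm_smul, Real.norm_of_nonneg hbj]
      nlinarith [mul_le_mul_of_nonneg_left h2 hbj]
  have h1 := key m hnm le_rfl
  have h2 := hW m hnm le_rfl
  calc ‖∑ i ∈ Finset.Ico n m, b i • v i‖
      ≤ ‖∑ i ∈ Finset.Ico n m, b i • v i - b m • ∑ i ∈ Finset.Ico n m, v i‖
        + ‖b m • ∑ i ∈ Finset.Ico n m, v i‖ := norm_le_norm_sub_add _ _
    _ ≤ (b n - b m) * W + b m * W := by
        rw [norm_smul, Real.norm_of_nonneg (hb0 m hnm)]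
        gcongr
        exact hb0 m hnm
    _ = b n * W := by ring

/-- Weighted noise sums over short windows are eventually below any number exceeding the
noise level. -/
lemma StepSizes.eventually_norm_sum_smul_le {α : ℕ → ℝ} (hα : StepSizes α) {r W : ℝ} (hr : 0 < r)
    {w : ℕ → E} (hW : 0 < W) (hw : noiseLevel α r w < ENNReal.ofReal W) :
    ∀ᶠ n in atTop, ∀ m, n ≤ m → gam α m - gam α n ≤ 1 →
      ‖∑ i ∈ Finset.Ico n m, α i • w i‖ ≤ W * gam α n ^ (-r) := by
  filter_upwards [eventually_lt_of_limsup_lt hw, hα.sum_infinite.eventually_gt_atTop 0]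
    with n hn hpos m hnm hm
  have hpart : ∀ j, n ≤ j → j ≤ m →
      ‖∑ i ∈ Finset.Ico n j, (α i * gam α i ^ r) • w i‖ ≤ W := by
    intro j hnj hjm
    rcases hnj.eq_or_lt with rfl | hlt
    · simpa using hW.le
    obtain ⟨k, rfl⟩ : ∃ k, j = k + 1 := ⟨j - 1, by omega⟩
    -- The sum over [n, j) ends at k = j - 1, so j ≤ `aIdx α n 1` is exactly the strict bound on k
    -- that the noise level requires.
    have hk : k ∈ Finset.Ico n (aIdx α n 1) := Finset.mem_Ico.2 ⟨by omega,
      hα.le_aIdx hnj ((sub_le_sub_right (hα.gam_mono hjm) _).trans hm)⟩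
    have h1 := (Finset.le_sup (f := fun k : ℕ =>
      ‖∑ i ∈ Finset.Icc n k, (α i * gam α i ^ r) • w i‖ₑ) hk).trans_lt hn
    rw [← Finset.Ico_add_one_right_eq_Icc n k] at h1
    have h2 := ENNReal.toReal_mono ENNReal.ofReal_ne_top h1.le
    rwa [toReal_enorm, ENNReal.toReal_ofReal hW.le] at h2
  have hposi : ∀ i, n ≤ i → 0 < gam α i := fun i hi => hpos.trans_le (hα.gam_mono hi)
  have h := norm_sum_smul_le_of_antitone (b := fun i => gam α i ^ (-r)) hnm
    (fun i hi => Real.rpow_le_rpow_of_nonpos (hposi i hi) (hα.gam_mono (Nat.le_succ i))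
      (by linarith))
    (fun i hi => (Real.rpow_pos_of_pos (hposi i hi) _).le) hpart
  rw [mul_comm]
  convert h using 3 with i hi
  have hi' := hposi i (Finset.mem_Ico.1 hi).1
  rw [smul_smul]
  congr 1
  have := Real.rpow_pos_of_pos hi' r
  rw [Real.rpow_neg hi'.le]
  field_simp

variable [CompleteSpace E] {f : E → ℝ}

/-- The gradient descent inequality between two points, if the gradient is Lipschitz around
the first of them. -/
lemma le_add_inner_gradient_add (hf : Differentiable ℝ f) {x y : E} {C D : ℝ} (hC : 0 ≤ C)
    (hxy : ‖y - x‖ ≤ D)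
    (hlip : ∀ z, ‖z - x‖ ≤ D → ‖gradient f z - gradient f x‖ ≤ C * ‖z - x‖) :
    f y ≤ f x + inner ℝ (gradient f x) (y - x) + C * D ^ 2 := by
  have hD : 0 ≤ D := (norm_nonneg _).trans hxy
  have h := (convex_closedBall x D).norm_image_sub_le_of_norm_hasFDerivWithin_le'
    (f := f) (f' := fun z => InnerProductSpace.toDual ℝ E (gradient f z))
    (φ := InnerProductSpace.toDual ℝ E (gradient f x)) (C := C * D) (x := x) (y := y)
    (fun z _ => (hf z).hasGradientAt.hasFDerivAt.hasFDerivWithinAt)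
    (fun z hz => by
      rw [mem_closedBall_iff_norm] at hz
      rw [← map_sub, LinearIsometryEquiv.norm_map]
      exact (hlip z hz).trans (by gcongr))
    (Metric.mem_closedBall_self hD) (mem_closedBall_iff_norm.2 hxy)
  rw [InnerProductSpace.toDual_apply_apply, Real.norm_eq_abs] at h
  have h1 := (abs_le.1 h).2
  have h2 : C * D * ‖y - x‖ ≤ C * D * D := by gcongr
  nlinarith

/-- A realization of the stochastic gradient recursion. -/
def IsGradientPath (f : E → ℝ) (α : ℕ → ℝ) (w x : ℕ → E) : Prop :=
  ∀ n, x (n + 1) = x n - α n • (gradient f (x n) + w n)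

lemma IsGradientPath.eq_sub {α : ℕ → ℝ} {w x : ℕ → E} (hx : IsGradientPath f α w x) {n m : ℕ}
    (h : n ≤ m) : x m - x n = -(∑ i ∈ Finset.Ico n m, α i • gradient f (x i)) -
      ∑ i ∈ Finset.Ico n m, α i • w i := by
  induction m, h using Nat.le_induction with
  | base => simp
  | succ m h ih =>
    rw [Finset.sum_Ico_succ_top h, Finset.sum_Ico_succ_top h, hx m]
    rw [sub_eq_iff_eq_add] at ih
    rw [ih]
    module

section window

variable {α : ℕ → ℝ} {w x : ℕ → E} {C ε : ℝ} {n m : ℕ}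

/-- A bootstrap: if the bounds hold at all earlier indices, summing the recursion gives a
displacement of at most τg + ε + 2Cτ(τg + ε), and Cτ ≤ 1/64 leaves room below the factor 2. The
window length τ, not the elapsed time, enters the bound so that it is the same for all j. -/
lemma IsGradientPath.norm_sub_le (hx : IsGradientPath f α w x) (hα : StepSizes α) (hC : 1 ≤ C)
    (hε : 0 ≤ ε) (hm : gam α m - gam α n ≤ 1 / (64 * C))
    (hlip : ∀ z, ‖z - x n‖ ≤ 2 * (‖gradient f (x n)‖ + ε) →
      ‖gradient f z - gradient f (x n)‖ ≤ C * ‖z - x n‖)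
    (hw : ∀ j, n ≤ j → j ≤ m → ‖∑ i ∈ Finset.Ico n j, α i • w i‖ ≤ ε) (hnm : n ≤ m) :
    ∀ j, n ≤ j → j ≤ m →
      ‖x j - x n‖ ≤ 2 * ((gam α m - gam α n) * ‖gradient f (x n)‖ + ε) ∧
      ‖gradient f (x j) - gradient f (x n)‖ ≤
        C * (2 * ((gam α m - gam α n) * ‖gradient f (x n)‖ + ε)) := by
  set τ := gam α m - gam α n with hτ
  set g := ‖gradient f (x n)‖ with hg
  have hg0 : 0 ≤ g := norm_nonneg _
  have hτ0 : 0 ≤ τ := sub_nonneg.2 (hα.gam_mono hnm)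
  have hCτ : C * τ ≤ 1 / 64 := by
    rw [le_div_iff₀ (by positivity)] at hm; linarith
  have hτ1 : τ ≤ 1 := by nlinarith
  intro j
  induction j using Nat.strong_induction_on with
  | _ j ih =>
    intro hnj hjm
    have hd : ‖x j - x n‖ ≤ 2 * (τ * g + ε) := by
      rw [hx.eq_sub hnj, ← norm_neg, neg_sub, sub_neg_eq_add]
      refine (norm_add_le _ _).trans ?_
      have h1 : ‖∑ i ∈ Finset.Ico n j, α i • gradient f (x i)‖ ≤
          ∑ i ∈ Finset.Ico n j, α i * (g + C * (2 * (τ * g + ε))) := by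
        refine norm_sum_le_of_le _ fun i hi => ?_
        rw [Finset.mem_Ico] at hi
        rw [norm_smul, Real.norm_of_nonneg (hα.pos i).le]
        refine mul_le_mul_of_nonneg_left ?_ (hα.pos i).le
        have h2 := (ih i hi.2 hi.1 (by omega)).2
        have h3 := norm_le_norm_add_norm_sub (gradient f (x n)) (gradient f (x i))
        rw [norm_sub_rev] at h3
        linarith
      rw [← Finset.sum_mul, ← gam_sub hnj] at h1
      have h4 : gam α j - gam α n ≤ τ := sub_le_sub_right (hα.gam_mono hjm) _
      have h5 : (gam α j - gam α n) * (g + C * (2 * (τ * g + ε))) ≤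
          τ * (g + C * (2 * (τ * g + ε))) := by gcongr
      have h6 := hw j hnj hjm
      have h7 : C * τ * (τ * g + ε) ≤ 1 / 64 * (τ * g + ε) := by gcongr
      have h8 : 0 ≤ τ * g := by positivity
      linarith
    refine ⟨hd, (hlip _ (hd.trans ?_)).trans (by gcongr)⟩
    have : τ * g ≤ g := by nlinarith
    linarith

/-- Second-order expansion at the start of the window. Replacing later gradients by the first one
and bounding the quadratic term cost 1/32 + 1/8 of τg², leaving 27/32; the cross term with the noise
is split by Young's inequality. -/
lemma IsGradientPath.descent (hx : IsGradientPath f α w x) (hf : Differentiable ℝ f)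
    (hα : StepSizes α) (hC : 1 ≤ C)
    (hε : 0 ≤ ε) (hm : gam α m - gam α n ≤ 1 / (64 * C))
    (hlip : ∀ z, ‖z - x n‖ ≤ 2 * (‖gradient f (x n)‖ + ε) →
      ‖gradient f z - gradient f (x n)‖ ≤ C * ‖z - x n‖)
    (hw : ∀ j, n ≤ j → j ≤ m → ‖∑ i ∈ Finset.Ico n j, α i • w i‖ ≤ ε) (hnm : n ≤ m) :
    f (x m) ≤ f (x n) - 27 / 32 * (gam α m - gam α n) * ‖gradient f (x n)‖ ^ 2
      + 33 / 256 * (1 / (64 * C)) * ‖gradient f (x n)‖ ^ 2 + 140 * C * ε ^ 2 := by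
  have hclose := hx.norm_sub_le hα hC hε hm hlip hw hnm
  set τ := gam α m - gam α n with hτ
  set g := ‖gradient f (x n)‖ with hg
  set T := 1 / (64 * C) with hT
  have hg0 : 0 ≤ g := norm_nonneg _
  have hτ0 : 0 ≤ τ := sub_nonneg.2 (hα.gam_mono hnm)
  have hCT : C * T = 1 / 64 := by rw [hT]; field_simp
  have hT0 : 0 < T := by positivity
  have hCτ : C * τ ≤ 1 / 64 := hCT ▸ by gcongr
  have hτ1 : τ ≤ 1 := by nlinarith
  set D := 2 * (τ * g + ε) with hD
  have hDle : D ≤ 2 * (g + ε) := by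
    have : τ * g ≤ g := by nlinarith
    linarith
  have h1 := le_add_inner_gradient_add hf (by linarith : 0 ≤ C) (hclose m hnm le_rfl).1
    (fun z hz => hlip z (hz.trans hDle))
  have h2 : inner ℝ (gradient f (x n)) (x m - x n) ≤ -(τ * (g ^ 2 - g * (C * D))) + g * ε := by
    rw [hx.eq_sub hnm, inner_sub_right, inner_neg_right, inner_sum]
    have h3 : τ * (g ^ 2 - g * (C * D)) ≤
        ∑ i ∈ Finset.Ico n m, inner ℝ (gradient f (x n)) (α i • gradient f (x i)) := by
      rw [hτ, gam_sub hnm, Finset.sum_mul]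
      refine Finset.sum_le_sum fun i hi => ?_
      rw [Finset.mem_Ico] at hi
      rw [inner_smul_right]
      refine mul_le_mul_of_nonneg_left ?_ (hα.pos i).le
      have h4 : inner ℝ (gradient f (x n)) (gradient f (x i)) =
          g ^ 2 + inner ℝ (gradient f (x n)) (gradient f (x i) - gradient f (x n)) := by
        rw [inner_sub_right, real_inner_self_eq_norm_sq]; ring
      have h5 := (abs_le.1 (abs_real_inner_le_norm (gradient f (x n))
        (gradient f (x i) - gradient f (x n)))).1
      have h6 : g * ‖gradient f (x i) - gradient f (x n)‖ ≤ g * (C * D) := by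
        gcongr
        exact (hclose i hi.1 hi.2.le).2
      linarith
    have h7 := (abs_le.1 (abs_real_inner_le_norm (gradient f (x n))
      (∑ i ∈ Finset.Ico n m, α i • w i))).1
    have h8 : g * ‖∑ i ∈ Finset.Ico n m, α i • w i‖ ≤ g * ε := by
      gcongr
      exact hw m hnm le_rfl
    linarith
  have h9 : τ * (g * (C * D)) ≤ τ * g ^ 2 / 32 + g * ε / 32 := by
    have e1 : τ * (g * (C * D)) = C * τ * (2 * (τ * g ^ 2 + g * ε)) := by rw [hD]; ring
    have e2 : C * τ * (2 * (τ * g ^ 2 + g * ε)) ≤ 1 / 64 * (2 * (τ * g ^ 2 + g * ε)) := by gcongr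
    linarith
  have h10 : C * D ^ 2 ≤ τ * g ^ 2 / 8 + 8 * C * ε ^ 2 := by
    have e1 : C * D ^ 2 ≤ 8 * (C * τ * (τ * g ^ 2)) + 8 * C * ε ^ 2 := by
      rw [hD]
      nlinarith [mul_nonneg (by linarith : 0 ≤ C) (sq_nonneg (τ * g - ε))]
    have e2 : C * τ * (τ * g ^ 2) ≤ 1 / 64 * (τ * g ^ 2) := by gcongr
    linarith
  -- The cross term has total coefficient 33/32, which yields 33/256 T g² and 132 C ε²; the
  -- remaining 8 C ε² comes from the quadratic term.
  have h11 : g * ε ≤ T / 8 * g ^ 2 + 128 * C * ε ^ 2 := by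
    have e1 : 0 ≤ C * (T * g - 4 * ε) ^ 2 := by positivity
    have e2 : C * (T * g - 4 * ε) ^ 2 =
        1 / 64 * (T * g ^ 2) - 1 / 8 * (g * ε) + 16 * (C * ε ^ 2) := by
      linear_combination (T * g ^ 2 - 8 * g * ε) * hCT
    linarith
  have h12 : 0 ≤ T * g ^ 2 := by positivity
  have h13 : 0 ≤ C * ε ^ 2 := by positivity
  linarith

/-- Along a gradient path with small noise, the energy `f - a` descends eventually. -/
lemma IsGradientPath.eventualDescent (hx : IsGradientPath f α w x) (hf : Differentiable ℝ f)
    (hα : StepSizes α) {r W a δ M μ : ℝ} (hC : 1 ≤ C) (hr : 0 < r) (hW : 0 < W)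
    (hw : noiseLevel α r w < ENNReal.ofReal W)
    (hlip : ∀ᶠ n in atTop, ∀ z, ‖z - x n‖ ≤ 2 * (‖gradient f (x n)‖ + W * gam α n ^ (-r)) →
      ‖gradient f z - gradient f (x n)‖ ≤ C * ‖z - x n‖)
    (hloja : ∀ᶠ n in atTop, |f (x n) - a| ≤ δ → |f (x n) - a| ≤ M * ‖gradient f (x n)‖ ^ μ) :
    EventualDescent (gam α) (fun n => f (x n) - a) (fun n => ‖gradient f (x n)‖)
      (fun t => 140 * C * (W * t ^ (-r)) ^ 2) (1 / (64 * C)) (1 / (256 * C)) δ M μ := by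
  -- The choice c = T/4 serves both fields: for τ ≥ T/2 the drop is at least (27/64 - 33/256) T g² ≥
  -- T g²/4, and the rise is at most 33/256 T g² ≤ T g²/4.
  have hTc : 1 / (256 * C) = 1 / 4 * (1 / (64 * C)) := by field_simp; norm_num
  have hT0 : 0 < 1 / (64 * C) := by positivity
  have hT1 : 1 / (64 * C) ≤ 1 := by
    rw [div_le_one (by positivity)]; linarith
  have hev : ∀ᶠ n in atTop, ∀ m, n ≤ m → gam α m - gam α n ≤ 1 / (64 * C) →
      f (x m) ≤ f (x n) - 27 / 32 * (gam α m - gam α n) * ‖gradient f (x n)‖ ^ 2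
      + 33 / 256 * (1 / (64 * C)) * ‖gradient f (x n)‖ ^ 2
      + 140 * C * (W * gam α n ^ (-r)) ^ 2 := by
    filter_upwards [hlip, hα.eventually_norm_sum_smul_le hr hW hw,
      hα.sum_infinite.eventually_ge_atTop 0] with n h1 h2 h3 m hnm hm
    exact hx.descent hf hα hC (by positivity) hm h1 (fun j hnj hjm => h2 j hnj
      ((sub_le_sub_right (hα.gam_mono hjm) _).trans (hm.trans hT1))) hnm
  refine ⟨?_, ?_, hloja⟩
  · filter_upwards [hev, hα.eventually_exists_window hT0] with n h1 h2
    obtain ⟨m, hnm, hm1, hm2⟩ := h2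
    refine ⟨m, hnm, hm2, ?_⟩
    have h3 := h1 m hnm.le hm2
    have h4 : 1 / (64 * C) / 2 * ‖gradient f (x n)‖ ^ 2 ≤
      (gam α m - gam α n) * ‖gradient f (x n)‖ ^ 2 := by gcongr
    have h5 : 0 ≤ 1 / (64 * C) * ‖gradient f (x n)‖ ^ 2 := by positivity
    rw [hTc]
    linarith
  · filter_upwards [hev] with n h1 m hnm hm
    have h3 := h1 m hnm hm
    have h4 : 0 ≤ (gam α m - gam α n) * ‖gradient f (x n)‖ ^ 2 :=
      mul_nonneg (sub_nonneg.2 (hα.gam_mono hnm)) (sq_nonneg _)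
    have h5 : 0 ≤ 1 / (64 * C) * ‖gradient f (x n)‖ ^ 2 := by positivity
    rw [hTc]
    linarith

end window

end

/-! ### Explicit barriers -/

/-- A constant is a barrier for an error tending to zero. -/
lemma exists_isBarrier_const {E : ℝ → ℝ} {T c δ M μ η G₀ : ℝ} (hc : 0 < c)
    (hM : 0 < M) (hη : 0 < η) (hηδ : η ≤ δ) (hE : Tendsto E atTop (𝓝 0))
    (hE0 : ∀ t, G₀ ≤ t → 0 ≤ E t) (hEa : AntitoneOn E (Set.Ici G₀)) :
    ∃ G, IsBarrier (fun _ => η) E T c δ M μ G := by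
  have h1 : 0 < c * (η / (2 * M)) ^ (2 / μ) := by positivity
  obtain ⟨G, hG⟩ := eventually_atTop.1 ((hE.eventually_lt_const (half_pos hη)).and
    ((hE.eventually_lt_const h1).and (eventually_ge_atTop G₀)))
  refine ⟨G, fun _ _ => hη, fun _ _ => hηδ, fun _ _ _ _ _ => le_rfl,
    fun t ht => hE0 t (hG t ht).2.2, fun a ha b hb => hEa (hG a ha).2.2 (hG b hb).2.2,
    fun t ht => ?_, fun t ht => ?_⟩
  · linarith [(hG t ht).1]
  · linarith [(hG t ht).2.1]

/-- Treats strict and critical exponents together: a positive exponent wins against any constant, so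
a condition on constants is needed only when the exponent vanishes. -/
lemma eventually_mul_rpow_neg_le {A a D : ℝ} (ha : 0 ≤ a) (hD : 0 < D) (h : a = 0 → A ≤ D) :
    ∀ᶠ t : ℝ in atTop, A * t ^ (-a) ≤ D := by
  rcases ha.eq_or_lt with rfl | ha
  · exact Eventually.of_forall fun t => by simpa using h rfl
  · have h1 := (tendsto_rpow_neg_atTop ha).const_mul A
    rw [mul_zero] at h1
    exact (h1.eventually_lt_const hD).mono fun _ => le_of_lt

/-- Bernoulli's inequality for a negative exponent, from e^y ≥ 1 + y and log(1 + h) ≤ h; it limits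
how fast a power barrier decays over one window. -/
lemma rpow_neg_mul_le_add_rpow_neg {t T p : ℝ} (ht : 0 < t) (hT : 0 ≤ T) (hp : 0 ≤ p) :
    t ^ (-p) * (1 - p * (T / t)) ≤ (t + T) ^ (-p) := by
  have h0 : 0 < 1 + T / t := by positivity
  have h1 : t + T = t * (1 + T / t) := by field_simp
  rw [h1, Real.mul_rpow ht.le h0.le]
  gcongr
  rw [Real.rpow_def_of_pos h0]
  have h2 := Real.log_le_sub_one_of_pos h0
  have h3 := Real.add_one_le_exp (Real.log (1 + T / t) * -p)
  nlinarith

lemma antitoneOn_rpow_neg {p : ℝ} (hp : 0 ≤ p) :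
    AntitoneOn (fun t : ℝ => t ^ (-p)) (Set.Ioi 0) := fun _ ha _ _ hab =>
  Real.rpow_le_rpow_of_nonpos ha hab (by linarith)

lemma antitoneOn_error {e W r : ℝ} (he : 0 ≤ e) (hW : 0 ≤ W) (hr : 0 ≤ r) :
    AntitoneOn (fun t : ℝ => e * (W * t ^ (-r)) ^ 2) (Set.Ioi 0) := fun a ha b hb hab => by
  have h1 := antitoneOn_rpow_neg hr ha hb hab
  have h2 : (0 : ℝ) ≤ b ^ (-r) := Real.rpow_nonneg (le_of_lt hb) _
  simp only at h1 ⊢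
  gcongr

/-- Inverse powers of the clock are barriers, under sharp conditions in the critical cases. -/
lemma exists_isBarrier_rpow {e W r r' T c δ M μ B : ℝ} (he : 0 ≤ e) (hW : 0 ≤ W)
    (hr' : 0 < r') (hrr : r' ≤ r) (hT : 0 < T) (hc : 0 < c) (hδ : 0 < δ) (hM : 0 < M)
    (hμ : 0 < μ) (hμ2 : μ ≤ 2) (hB : 0 < B) (hrμ : r' * (2 - μ) ≤ 1)
    (h₁ : r' = r → e * W ^ 2 ≤ c / 4 * (B / (2 * M)) ^ (2 / μ))
    (h₂ : r' * (2 - μ) = 1 → B * (μ * r') * T ≤ c / 2 * (B / (2 * M)) ^ (2 / μ))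
    (h₃ : r' = r → μ = 2 → e * W ^ 2 ≤ B / 4) :
    ∃ G, 0 < G ∧ IsBarrier (fun t => B * t ^ (-(μ * r'))) (fun t => e * (W * t ^ (-r)) ^ 2)
      T c δ M μ G := by
  set p := μ * r' with hp
  set X := (B / (2 * M)) ^ (2 / μ) with hX
  have hX0 : 0 < X := by positivity
  have hp0 : 0 < p := by positivity
  have hp2 : p ≤ 2 * r' := by rw [hp]; gcongr
  -- Three comparisons of powers: the error t^(-2r) and the barrier's decay t^(-p-1) against the
  -- slope term t^(-2r') in `drop`, then the error against t^(-p) in `half`. They are critical when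
  -- r' = r, when r'(2-μ) = 1, and when both r' = r and μ = 2.
  have ev₁ := eventually_mul_rpow_neg_le (A := e * W ^ 2) (a := 2 * r - 2 * r') (by linarith)
    (by positivity : 0 < c / 4 * X) (fun h => h₁ (by linarith))
  have ev₂ := eventually_mul_rpow_neg_le (A := B * p * T) (a := 1 - r' * (2 - μ)) (by linarith)
    (by positivity : 0 < c / 2 * X) (fun h => h₂ (by linarith))
  have ev₃ := eventually_mul_rpow_neg_le (A := e * W ^ 2) (a := 2 * r - p) (by linarith)
    (by positivity : 0 < B / 4) (fun h => h₃ (by linarith) (by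
      have h1 : p = 2 * r' := by linarith
      exact mul_right_cancel₀ hr'.ne' h1))
  have ev₄ := eventually_mul_rpow_neg_le (A := B) (a := p) hp0.le hδ (fun h => absurd h hp0.ne')
  obtain ⟨G, hG⟩ := eventually_atTop.1 (ev₁.and (ev₂.and (ev₃.and (ev₄.and
    (eventually_ge_atTop (4 * p * T + 1))))))
  have hGpos : 0 < G := by
    have : 0 < p * T := by positivity
    linarith [(hG G le_rfl).2.2.2.2]
  have hpos : ∀ t, G ≤ t → 0 < t := fun t ht => hGpos.trans_le ht
  have herr : ∀ t, 0 < t → e * (W * t ^ (-r)) ^ 2 = e * W ^ 2 * t ^ (-(2 * r)) := by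
    intro t ht
    have : t ^ (-(2 * r)) = (t ^ (-r)) ^ 2 := by
      rw [← Real.rpow_natCast, ← Real.rpow_mul ht.le]; congr 1; push_cast; ring
    rw [this]; ring
  refine ⟨G, hGpos, fun t ht => ?_, fun t ht => (hG t ht).2.2.2.1,
    fun a ha b hb hab => ?_, fun t ht => ?_, fun a ha b hb hab =>
    antitoneOn_error he hW (hr'.le.trans hrr) (hpos a ha) (hpos b hb) hab,
    fun t ht => ?_, fun t ht => ?_⟩
  · have := hpos t ht
    positivity
  · exact mul_le_mul_of_nonneg_left (antitoneOn_rpow_neg hp0.le (hpos a ha) (hpos b hb) hab) hB.le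
  · positivity
  · have ht0 := hpos t ht
    obtain ⟨-, -, h3, -, h5⟩ := hG t ht
    have h6 := rpow_neg_mul_le_add_rpow_neg ht0 hT.le hp0.le
    have h7 : p * (T / t) ≤ 1 / 4 := by
      rw [← mul_div_assoc, div_le_iff₀ ht0]; linarith
    have h8 : 0 < t ^ (-p) := by positivity
    have h9 : e * W ^ 2 * t ^ (-(2 * r)) ≤ B / 4 * t ^ (-p) := by
      have : t ^ (-(2 * r)) = t ^ (-(2 * r - p)) * t ^ (-p) := by
        rw [← Real.rpow_add ht0]; congr 1; ring
      rw [this, ← mul_assoc]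
      gcongr
    have h10 : t ^ (-p) * (3 / 4) ≤ (t + T) ^ (-p) :=
      (mul_le_mul_of_nonneg_left (by linarith) h8.le).trans h6
    have h11 := mul_le_mul_of_nonneg_left h10 hB.le
    simp only [herr t ht0]
    linarith
  · have ht0 := hpos t ht
    obtain ⟨h1, h2, -, -, -⟩ := hG t ht
    have h6 := mul_le_mul_of_nonneg_left (rpow_neg_mul_le_add_rpow_neg ht0 hT.le hp0.le) hB.le
    have h8 : 0 < t ^ (-(2 * r')) := by positivity
    have e1 : (B * t ^ (-p) / (2 * M)) ^ (2 / μ) = X * t ^ (-(2 * r')) := by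
      rw [mul_div_right_comm, Real.mul_rpow (by positivity) (by positivity),
        ← Real.rpow_mul ht0.le]
      congr 2
      rw [hp]; field_simp
    have e2 : t ^ (-(2 * r)) = t ^ (-(2 * r - 2 * r')) * t ^ (-(2 * r')) := by
      rw [← Real.rpow_add ht0]; congr 1; ring
    have e3 : t ^ (-p) / t = t ^ (-(1 - r' * (2 - μ))) * t ^ (-(2 * r')) := by
      rw [← Real.rpow_add ht0, ← Real.rpow_sub_one ht0.ne']; congr 1; rw [hp]; ring
    have h9 := mul_le_mul_of_nonneg_right h1 h8.le
    have h10 := mul_le_mul_of_nonneg_right h2 h8.le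
    have e4 : B * (t ^ (-p) * (1 - p * (T / t))) = B * t ^ (-p) - B * p * T * (t ^ (-p) / t) := by
      ring
    rw [e4, e3] at h6
    simp only [herr t ht0, e1, e2]
    have h11 : 0 ≤ c * (X * t ^ (-(2 * r'))) := by positivity
    linarith

/-! ### From eventual bounds to limits -/

lemma tendsto_zero_of_forall_eventually_le {v : ℕ → ℝ} {δ κ : ℝ} (hδ : 0 < δ) (hκ : 0 < κ)
    (h : ∀ η, 0 < η → η ≤ δ → ∀ᶠ n in atTop, |v n| ≤ κ * η) : Tendsto v atTop (𝓝 0) := by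
  rw [Metric.tendsto_nhds]
  intro ε hε
  filter_upwards [h (min δ (ε / (2 * κ))) (by positivity) (min_le_left _ _)] with n hn
  rw [Real.dist_eq, sub_zero]
  have h1 : κ * min δ (ε / (2 * κ)) ≤ κ * (ε / (2 * κ)) := by gcongr; exact min_le_right _ _
  have h2 : κ * (ε / (2 * κ)) = ε / 2 := by field_simp
  linarith

/-- A shift of the clock does not affect the leading constant of a polynomial rate. -/
lemma limsup_ofReal_rpow_mul_le {γ v : ℕ → ℝ} {A p s : ℝ} (hγ : Tendsto γ atTop atTop)
    (h : ∀ᶠ n in atTop, v n ≤ A * (γ n - s) ^ (-p)) :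
    limsup (fun n => ENNReal.ofReal (γ n ^ p * v n)) atTop ≤ ENNReal.ofReal A := by
  have hinv : Tendsto (fun n => 1 - s * (γ n)⁻¹) atTop (𝓝 1) := by
    simpa using (tendsto_inv_atTop_zero.comp hγ).const_mul s |>.const_sub 1
  have hlim : Tendsto (fun n => ENNReal.ofReal (A * (1 - s * (γ n)⁻¹) ^ (-p))) atTop
      (𝓝 (ENNReal.ofReal A)) := by
    refine (ENNReal.continuous_ofReal.tendsto _).comp ?_
    have h1 := (hinv.rpow_const (p := -p) (Or.inl one_ne_zero)).const_mul A
    simpa using h1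
  rw [← hlim.limsup_eq]
  refine limsup_le_limsup ?_
  filter_upwards [h, hγ.eventually_gt_atTop 0, hγ.eventually_gt_atTop s] with n hn h0 hs
  refine ENNReal.ofReal_le_ofReal ?_
  have h1 : γ n - s = γ n * (1 - s * (γ n)⁻¹) := by field_simp
  have h2 : 0 ≤ 1 - s * (γ n)⁻¹ := by
    have h3 : s * (γ n)⁻¹ < 1 := by rw [← div_eq_mul_inv, div_lt_one h0]; exact hs
    linarith
  have h4 : 0 < γ n ^ p := Real.rpow_pos_of_pos h0 _
  calc γ n ^ p * v n ≤ γ n ^ p * (A * (γ n - s) ^ (-p)) := by gcongr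
    _ = A * (1 - s * (γ n)⁻¹) ^ (-p) := by
      rw [h1, Real.mul_rpow h0.le h2, Real.rpow_neg h0.le]
      field_simp

/-! ### Bounded paths: accumulation set and convergence -/

section

variable {E : Type*} [NormedAddCommGroup E] {x : ℕ → E}

lemma BoundedPath.exists_norm_le [InnerProductSpace ℝ E] (hb : BoundedPath x) :
    ∃ R, ∀ n, ‖x n‖ ≤ R := by
  obtain ⟨R, hR⟩ := hb
  exact ⟨R, fun n => hR ⟨n, rfl⟩⟩

lemma BoundedPath.qHat_eq [InnerProductSpace ℝ E] (hb : BoundedPath x) (ρ : ℝ) :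
    QHat x ρ = {y | Metric.infDist y (accSet x) ≤ ρ} := by
  rw [QHat, if_pos hb]

lemma BoundedPath.accSet_subset_qHat [InnerProductSpace ℝ E] (hb : BoundedPath x) {ρ : ℝ}
    (hρ : 0 ≤ ρ) : accSet x ⊆ QHat x ρ := fun y hy => by
  rw [hb.qHat_eq]
  exact (Metric.infDist_zero_of_mem hy).le.trans hρ

variable [InnerProductSpace ℝ E] [ProperSpace E]

/-- Compactness of a closed ball cut by a closed condition. It yields nonemptiness of the
accumulation set, convergence of the path to it, and attainment of `fHat`. -/
lemma BoundedPath.exists_cluster (hb : BoundedPath x) {p : E → Prop} (hp : IsClosed {y | p y})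
    (h : ∃ᶠ n in atTop, p (x n)) : ∃ y ∈ accSet x, p y := by
  obtain ⟨R, hR⟩ := hb.exists_norm_le
  obtain ⟨y, hy, hyx⟩ :=
    ((isCompact_closedBall (0 : E) R).inter_right hp).exists_mapClusterPt_of_frequently
      (l := atTop) (f := x) (h.mono fun n hn => ⟨mem_closedBall_zero_iff.2 (hR n), hn⟩)
  exact ⟨y, hyx, hy.2⟩

lemma BoundedPath.accSet_nonempty (hb : BoundedPath x) : (accSet x).Nonempty := by
  obtain ⟨y, hy, -⟩ := hb.exists_cluster (p := fun _ => True) (by simp)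
    (Eventually.of_forall fun _ => trivial).frequently
  exact ⟨y, hy⟩

lemma BoundedPath.eventually_infDist_le (hb : BoundedPath x) {ε : ℝ} (hε : 0 < ε) :
    ∀ᶠ n in atTop, Metric.infDist (x n) (accSet x) ≤ ε := by
  by_contra h
  rw [not_eventually] at h
  obtain ⟨y, hy, hyε⟩ := hb.exists_cluster (p := fun y => ε ≤ Metric.infDist y (accSet x))
    (isClosed_le continuous_const (Metric.continuous_infDist_pt _))
    (h.mono fun n hn => (not_le.1 hn).le)
  rw [Metric.infDist_zero_of_mem hy] at hyε
  linarith

lemma BoundedPath.isCompact_qHat (hb : BoundedPath x) (ρ : ℝ) : IsCompact (QHat x ρ) := by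
  rw [hb.qHat_eq]
  obtain ⟨R, hR⟩ := hb.exists_norm_le
  have hA : accSet x ⊆ Metric.closedBall 0 R := fun y hy =>
    Metric.isClosed_closedBall.mem_of_mapClusterPt hy
      (Eventually.of_forall fun n => mem_closedBall_zero_iff.2 (hR n))
  refine (isCompact_closedBall (0 : E) (R + ρ + 1)).of_isClosed_subset
    (isClosed_le (Metric.continuous_infDist_pt _) continuous_const) fun y hy => ?_
  obtain ⟨z, hz, hyz⟩ := (Metric.infDist_lt_iff hb.accSet_nonempty).1
    (lt_of_le_of_lt hy (lt_add_one ρ))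
  have h1 := mem_closedBall_zero_iff.1 (hA hz)
  rw [mem_closedBall_zero_iff]
  rw [dist_eq_norm] at hyz
  linarith [norm_le_norm_sub_add y z]

lemma BoundedPath.eventually_mem_qHat (hb : BoundedPath x) {ρ : ℝ} (hρ : 0 < ρ) :
    ∀ᶠ n in atTop, x n ∈ QHat x ρ := by
  rw [hb.qHat_eq]
  exact hb.eventually_infDist_le hρ

variable {f : E → ℝ}

lemma BoundedPath.isBounded_comp (hb : BoundedPath x) (hf : Continuous f) :
    IsBoundedUnder (· ≤ ·) atTop (fun n => f (x n)) ∧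
      IsBoundedUnder (· ≥ ·) atTop (fun n => f (x n)) := by
  obtain ⟨R, hR⟩ := hb.exists_norm_le
  obtain ⟨B, hB⟩ := (isCompact_closedBall (0 : E) R).exists_bound_of_continuousOn hf.continuousOn
  have h : ∀ n, |f (x n)| ≤ B := fun n => hB _ (mem_closedBall_zero_iff.2 (hR n))
  exact ⟨isBoundedUnder_of ⟨B, fun n => (abs_le.1 (h n)).2⟩,
    isBoundedUnder_of ⟨-B, fun n => (abs_le.1 (h n)).1⟩⟩

lemma BoundedPath.eventually_lt (hb : BoundedPath x) (hf : Continuous f) {a : ℝ}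
    (ha : a < fHat f x) : ∀ᶠ n in atTop, a < f (x n) :=
  eventually_lt_of_lt_liminf ha (hb.isBounded_comp hf).2

lemma BoundedPath.frequently_lt (hb : BoundedPath x) (hf : Continuous f) {a : ℝ}
    (ha : fHat f x < a) : ∃ᶠ n in atTop, f (x n) < a :=
  frequently_lt_of_liminf_lt (hb.isBounded_comp hf).1.isCoboundedUnder_ge ha

/-- The lower limit of `f` along a bounded sequence is attained at an accumulation point. -/
lemma BoundedPath.fHat_mem (hb : BoundedPath x) (hf : Continuous f) :
    fHat f x ∈ f '' accSet x := by
  have hA : IsCompact (accSet x) :=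
    (hb.isCompact_qHat 0).of_isClosed_subset isClosed_setOfPred_clusterPt
      (hb.accSet_subset_qHat le_rfl)
  refine (hA.image hf).isClosed.closure_subset (Metric.mem_closure_iff.2 fun ε hε => ?_)
  have h := ((hb.frequently_lt hf (lt_add_of_pos_right (fHat f x) (half_pos hε))).and_eventually
    (hb.eventually_lt hf (sub_lt_self (fHat f x) (half_pos hε)))).mono
    fun n hn => (abs_le.2 ⟨by linarith [hn.2], by linarith [hn.1]⟩ : |f (x n) - fHat f x| ≤ ε / 2)
  obtain ⟨y, hy, hyε⟩ := hb.exists_cluster (p := fun y => |f y - fHat f x| ≤ ε / 2)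
    (isClosed_le (by fun_prop) continuous_const) h
  refine ⟨f y, ⟨y, hy, rfl⟩, ?_⟩
  rw [dist_comm, Real.dist_eq]
  linarith

variable {α : ℕ → ℝ} {w : ℕ → E} {C : Set E → ℝ} {r δ M μ : ℝ}

lemma GradientBounds.continuous (hC : GradientBounds f C) : Continuous (gradient f) := by
  refine continuous_iff_continuousAt.2 fun x => ?_
  obtain ⟨-, -, h⟩ := hC _ (isCompact_closedBall x 1)
  have h1 : LipschitzOnWith (C (Metric.closedBall x 1)).toNNReal (gradient f)
      (Metric.closedBall x 1) := LipschitzOnWith.of_dist_le_mul fun y hy z hz => by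
    rw [dist_eq_norm, dist_eq_norm]
    exact (h y hy z hz).trans (mul_le_mul_of_nonneg_right (Real.le_coe_toNNReal _) (norm_nonneg _))
  exact h1.continuousOn.continuousAt (Metric.closedBall_mem_nhds x one_pos)

lemma tendsto_mul_gam_rpow_neg (hα : StepSizes α) (hr : 0 < r) (W : ℝ) :
    Tendsto (fun n => W * gam α n ^ (-r)) atTop (𝓝 0) := by
  simpa using ((tendsto_rpow_neg_atTop hr).comp hα.sum_infinite).const_mul W

/-- Convergence of the values and of the gradients along a bounded path. -/
lemma IsGradientPath.tendsto_zero (hx : IsGradientPath f α w x) (hf : Differentiable ℝ f)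
    (hα : StepSizes α) (hr : 0 < r) (hC : GradientBounds f C) (hb : BoundedPath x)
    (hw : noiseLevel α r w < ∞) (hδ : 0 < δ) (hM : 0 < M) (hμ : 0 < μ)
    (hloja : ∀ᶠ n in atTop, |f (x n) - fHat f x| ≤ δ →
      |f (x n) - fHat f x| ≤ M * ‖gradient f (x n)‖ ^ μ) :
    Tendsto (fun n => f (x n) - fHat f x) atTop (𝓝 0) ∧
      Tendsto (fun n => ‖gradient f (x n)‖) atTop (𝓝 0) := by
  obtain ⟨R, hR⟩ := hb.exists_norm_le
  obtain ⟨G, hG⟩ : ∃ G, ∀ n, ‖gradient f (x n)‖ ≤ G :=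
    ⟨_, fun n => (hC _ (isCompact_closedBall (0 : E) R)).2.1 _ (mem_closedBall_zero_iff.2 (hR n))⟩
  -- Once the noise bound is below 1, this ball contains every point admitted by the Lipschitz
  -- hypothesis of `eventualDescent`.
  obtain ⟨h1C, -, hlip⟩ := hC _ (isCompact_closedBall (0 : E) (R + 2 * (G + 1)))
  set C₀ := C (Metric.closedBall (0 : E) (R + 2 * (G + 1)))
  set W := (noiseLevel α r w).toReal + 1 with hWdef
  have hW : 0 < W := by positivity
  have hwW : noiseLevel α r w < ENNReal.ofReal W :=
    (ENNReal.lt_ofReal_iff_toReal_lt hw.ne).2 (lt_add_one _)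
  have hG0 : 0 ≤ G := (norm_nonneg _).trans (hG 0)
  have hdesc := hx.eventualDescent hf hα h1C hr hW hwW (by
    filter_upwards [(tendsto_mul_gam_rpow_neg hα hr W).eventually_lt_const one_pos] with n hn z hz
    have h1 := norm_le_norm_sub_add z (x n)
    refine hlip z (mem_closedBall_zero_iff.2 ?_) (x n) (mem_closedBall_zero_iff.2 ?_)
    · linarith [hR n, hG n]
    · linarith [hR n]) hloja
  have hE : Tendsto (fun t : ℝ => 140 * C₀ * (W * t ^ (-r)) ^ 2) atTop (𝓝 0) := by
    simpa using (((tendsto_rpow_neg_atTop hr).const_mul W).pow 2).const_mul (140 * C₀)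
  have hEa := (antitoneOn_error (e := 140 * C₀) (by linarith) hW.le hr.le).mono
    (Set.Ici_subset_Ioi.2 one_pos)
  have hc : 0 < 1 / (256 * C₀) := by positivity
  have hT : 0 < 1 / (64 * C₀) := by positivity
  have key : ∀ η, 0 < η → η ≤ δ → ∀ᶠ n in atTop, |f (x n) - fHat f x| ≤ 6 * η ∧
      1 / (256 * C₀) * ‖gradient f (x n)‖ ^ 2 ≤ 14 * η := by
    intro η hη hηδ
    obtain ⟨G', hG'⟩ := exists_isBarrier_const (T := 1 / (64 * C₀)) (μ := μ) hc hM hη hηδ hE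
      (fun t ht => by positivity) hEa
    obtain ⟨s, hs⟩ := hdesc.exists_shift hG' hM hμ hc hT.le (fun n => norm_nonneg _) hα.gam_mono
      hα.sum_infinite
      ((hb.eventually_lt hf.continuous (sub_lt_self _ hη)).mono fun n hn => by linarith)
      ((hb.frequently_lt hf.continuous (lt_add_of_pos_right _ hη)).mono fun n hn => by linarith)
    exact hs
  refine ⟨tendsto_zero_of_forall_eventually_le hδ (by norm_num : (0 : ℝ) < 6)
    fun η h1 h2 => (key η h1 h2).mono fun n hn => hn.1, ?_⟩
  have hsq : Tendsto (fun n => ‖gradient f (x n)‖ ^ 2) atTop (𝓝 0) :=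
    tendsto_zero_of_forall_eventually_le hδ (by positivity : 0 < 14 * (256 * C₀))
      fun η h1 h2 => (key η h1 h2).mono fun n hn => by
        rw [abs_of_nonneg (sq_nonneg _)]
        have := hn.2
        rw [one_div, inv_mul_le_iff₀ (by positivity)] at this
        linarith
  have := hsq.sqrt
  simpa [Real.sqrt_sq] using this

end

/-! ### Constants and critical exponents -/

/-- The constant in front of the barrier, depending on the gradient bound `C` and on the
Lojasiewicz constant `M`. -/
noncomputable def barrierConst (r C M : ℝ) : ℝ :=
  286720 * M * C ^ 2 + (1 + 64 * M ^ 2 * r) ^ (2 * r)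

section exponents

variable {r μ : ℝ}

/-- The value of `min {r, r̂}` in the three regimes `r < r̂`, `r = r̂` and `r > r̂`. -/
lemma min_rHat_cases (hμ2 : μ ≤ 2) :
    ((r : EReal) < rHat μ ∧ (min (r : EReal) (rHat μ)).toReal = r ∧ r * (2 - μ) < 1) ∨
    ((r : EReal) = rHat μ ∧ (min (r : EReal) (rHat μ)).toReal = r ∧ r * (2 - μ) = 1) ∨
    (rHat μ < r ∧ 0 < (min (r : EReal) (rHat μ)).toReal ∧
      (min (r : EReal) (rHat μ)).toReal < r ∧
      (min (r : EReal) (rHat μ)).toReal * (2 - μ) = 1) := by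
  rcases hμ2.lt_or_eq with h2 | rfl
  · have hpos : 0 < 2 - μ := by linarith
    have hR : rHat μ = ((1 / (2 - μ) : ℝ) : EReal) := if_pos h2
    rw [hR]
    rcases lt_trichotomy r (1 / (2 - μ)) with h | h | h
    · refine Or.inl ⟨EReal.coe_lt_coe_iff.2 h, ?_, (lt_div_iff₀ hpos).1 h⟩
      rw [min_eq_left (EReal.coe_le_coe_iff.2 h.le), EReal.toReal_coe]
    · refine Or.inr (Or.inl ⟨by rw [h], ?_, (eq_div_iff hpos.ne').1 h⟩)
      rw [min_eq_left (EReal.coe_le_coe_iff.2 h.le), EReal.toReal_coe]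
    · rw [min_eq_right (EReal.coe_le_coe_iff.2 h.le), EReal.toReal_coe]
      exact Or.inr (Or.inr ⟨EReal.coe_lt_coe_iff.2 h, by positivity, h, by field_simp⟩)
  · have hR : rHat 2 = ⊤ := if_neg (lt_irrefl _)
    rw [hR, min_eq_left le_top, EReal.toReal_coe]
    exact Or.inl ⟨EReal.coe_lt_top r, rfl, by norm_num⟩

lemma continuous_phi : Continuous (phi r μ) := by
  unfold phi
  split_ifs <;> fun_prop

lemma phi_ne_top {w : ℝ≥0∞} (hw : w ≠ ∞) : phi r μ w ≠ ∞ := by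
  unfold phi
  split_ifs <;> simp [hw]

/-- The exponents and the factor `F = φ(W)` meet the requirements of `exists_isBarrier_rpow`. -/
lemma phi_requirements (hr : 0 < r) (hμ2 : μ ≤ 2) {W : ℝ} (hW : 0 < W) :
    let r' := (min (r : EReal) (rHat μ)).toReal
    let F := (phi r μ (ENNReal.ofReal W)).toReal
    0 < r' ∧ r' ≤ r ∧ r' * (2 - μ) ≤ 1 ∧ 0 < F ∧ (r' = r → W ≤ F) ∧
      (r' * (2 - μ) = 1 → 1 ≤ F) := by
  intro r' F
  rcases min_rHat_cases hμ2 with ⟨h1, h2, h3⟩ | ⟨h1, h2, h3⟩ | ⟨h1, h2, h3, h4⟩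
  · have hF : F = W := by
      change (phi r μ (ENNReal.ofReal W)).toReal = W
      rw [phi, if_pos h1, ENNReal.toReal_ofReal hW.le]
    have hr' : r' = r := h2
    rw [hF, hr']
    exact ⟨hr, le_rfl, h3.le, hW, fun _ => le_rfl, fun h => absurd h h3.ne⟩
  · have hF : F = 1 + W := by
      change (phi r μ (ENNReal.ofReal W)).toReal = 1 + W
      rw [phi, if_neg h1.not_lt, if_pos h1, ENNReal.toReal_add ENNReal.one_ne_top
        ENNReal.ofReal_ne_top, ENNReal.toReal_ofReal hW.le, ENNReal.toReal_one]
    have hr' : r' = r := h2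
    rw [hF, hr']
    exact ⟨hr, le_rfl, h3.le, by linarith, fun _ => by linarith, fun _ => by linarith⟩
  · have hF : F = 1 := by
      change (phi r μ (ENNReal.ofReal W)).toReal = 1
      rw [phi, if_neg h1.not_gt, if_neg h1.ne', ENNReal.toReal_one]
    rw [hF]
    exact ⟨h2, h3.le, h4.le, one_pos, fun h => absurd h h3.ne, fun _ => le_rfl⟩

end exponents

/-- The barrier of order `γ ^ (-p̂)` with coefficient `barrierConst * φ(W) ^ μ`. -/
lemma exists_isBarrier_phi {r C M μ δ W : ℝ} (hr : 0 < r) (hC : 1 ≤ C) (hM : 1 ≤ M)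
    (hμ : 1 < μ) (hμ2 : μ ≤ 2) (hδ : 0 < δ) (hW : 0 < W) :
    ∃ G, 0 < G ∧ IsBarrier
      (fun t => barrierConst r C M * (phi r μ (ENNReal.ofReal W)).toReal ^ μ *
        t ^ (-(rateExp r μ μ)))
      (fun t => 140 * C * (W * t ^ (-r)) ^ 2) (1 / (64 * C)) (1 / (256 * C)) δ M μ G := by
  obtain ⟨hr', hrr, hrμ, hF, hWF, h1F⟩ := phi_requirements hr hμ2 hW
  set r' := (min (r : EReal) (rHat μ)).toReal with hr'def
  set F := (phi r μ (ENNReal.ofReal W)).toReal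
  set X := 1 + 64 * M ^ 2 * r with hX
  have hX1 : 1 ≤ X := by rw [hX]; linarith [show 0 ≤ 64 * M ^ 2 * r by positivity]
  have hK1 : 286720 * M * C ^ 2 ≤ barrierConst r C M :=
    le_add_of_nonneg_right (by positivity)
  have hK2 : X ^ (2 * r) ≤ barrierConst r C M :=
    le_add_of_nonneg_left (by positivity)
  set K := barrierConst r C M
  have hK0 : 0 < K := lt_of_lt_of_le (by positivity) hK1
  have hμ0 : 0 < μ := by linarith
  have hC2 : C ≤ C ^ 2 := by nlinarith
  refine exists_isBarrier_rpow (by positivity) hW.le hr' hrr (by positivity) (by positivity) hδ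
    (by positivity) hμ0 hμ2 (by positivity) hrμ (fun h => ?_) (fun h => ?_) (fun h h2 => ?_)
  -- The first summand of `barrierConst` handles the noise: 143360 = 140 · 256 · 4, doubled because
  -- of K/(2M).
  · have h1 : (K * F ^ μ / (2 * M)) ^ (2 / μ) = (K / (2 * M)) ^ (2 / μ) * F ^ 2 := by
      rw [mul_div_right_comm, Real.mul_rpow (by positivity) (by positivity),
        ← Real.rpow_mul hF.le, show μ * (2 / μ) = (2 : ℕ) by field_simp; norm_num,
        Real.rpow_natCast]
    have h2 : 143360 * C ^ 2 ≤ K / (2 * M) := by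
      rw [le_div_iff₀ (by positivity)]; linarith
    have h3 : K / (2 * M) ≤ (K / (2 * M)) ^ (2 / μ) := by
      refine Real.self_le_rpow_of_one_le (by nlinarith) ?_
      rwa [le_div_iff₀ hμ0, one_mul]
    have h4 : W ^ 2 ≤ F ^ 2 := by gcongr; exact hWF h
    rw [h1]
    calc 140 * C * W ^ 2 = 1 / (256 * C) / 4 * (143360 * C ^ 2 * W ^ 2) := by
          field_simp; norm_num
      _ ≤ 1 / (256 * C) / 4 * ((K / (2 * M)) ^ (2 / μ) * F ^ 2) := by
          gcongr
          exact h2.trans h3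
  · set B := K * F ^ μ with hB
    have hKB : K ≤ B := le_mul_of_one_le_right hK0.le (Real.one_le_rpow (h1F h) hμ0.le)
    have hB0 : 0 < B := hK0.trans_le hKB
    have hp0 : 0 < μ * r' := by positivity
    have hp2 : μ * r' ≤ 2 * r := by gcongr
    -- In the critical case r'(2-μ) = 1, p = μr' satisfies 2r' = 1 + p. The claim becomes
    -- 8p(2M)^(2/μ) ≤ B^(1/p), which the second summand of `barrierConst` ensures through p ≤ 2r and
    -- (2M)^(2/μ) ≤ 4M², uniformly in μ.
    have h2μ : 2 / μ = 1 + 1 / (μ * r') := by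
      field_simp; linarith
    have h1 : X ≤ B ^ (1 / (μ * r')) := by
      have e1 : X ^ (μ * r') ≤ B :=
        (Real.rpow_le_rpow_of_exponent_le hX1 hp2).trans (hK2.trans hKB)
      calc X = (X ^ (μ * r')) ^ (1 / (μ * r')) := by
            rw [← Real.rpow_mul (by positivity), mul_one_div_cancel hp0.ne', Real.rpow_one]
        _ ≤ B ^ (1 / (μ * r')) := by gcongr
    have h2 : (2 * M) ^ (2 / μ) ≤ 4 * M ^ 2 := by
      calc (2 * M) ^ (2 / μ) ≤ (2 * M) ^ (2 : ℝ) := by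
            refine Real.rpow_le_rpow_of_exponent_le (by linarith) ?_
            rw [div_le_iff₀ hμ0]; linarith
        _ = 4 * M ^ 2 := by rw [Real.rpow_two]; ring
    have h3 : (B / (2 * M)) ^ (2 / μ) = B * B ^ (1 / (μ * r')) / (2 * M) ^ (2 / μ) := by
      rw [Real.div_rpow hB0.le (by positivity)]
      congr 1
      rw [h2μ, Real.rpow_add hB0, Real.rpow_one]
    have h4 : 8 * (μ * r') * (2 * M) ^ (2 / μ) ≤ B ^ (1 / (μ * r')) := by
      calc 8 * (μ * r') * (2 * M) ^ (2 / μ) ≤ 8 * (2 * r) * (4 * M ^ 2) := by gcongr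
        _ ≤ X := by rw [hX]; linarith
        _ ≤ _ := h1
    have h5 : 8 * (B * (μ * r')) ≤ (B / (2 * M)) ^ (2 / μ) := by
      rw [h3, le_div_iff₀ (by positivity)]
      nlinarith
    calc B * (μ * r') * (1 / (64 * C)) = 1 / (256 * C) / 2 * (8 * (B * (μ * r'))) := by
          field_simp; norm_num
      _ ≤ 1 / (256 * C) / 2 * (B / (2 * M)) ^ (2 / μ) := by gcongr
  · rw [h2, Real.rpow_two]
    have h4 : W ^ 2 ≤ F ^ 2 := by gcongr; exact hWF h
    have h5 : 560 * C ≤ K := by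
      have : C ^ 2 ≤ M * C ^ 2 := le_mul_of_one_le_left (by positivity) hM
      nlinarith
    calc 140 * C * W ^ 2 = 560 * C * W ^ 2 / 4 := by ring
      _ ≤ K * F ^ 2 / 4 := by gcongr

/-- The constant in the convergence rates of the gradients and of the values. -/
noncomputable def rateConst (r C M : ℝ) : ℝ := max 1 (3584 * C * barrierConst r C M)

/-! ### Rates along a bounded path -/

section

variable {E : Type*} [NormedAddCommGroup E] [InnerProductSpace ℝ E] [ProperSpace E]
  {f : E → ℝ} {α : ℕ → ℝ} {w x : ℕ → E} {C : Set E → ℝ} {δ μ M : Set E → ℝ → ℝ} {r ρ : ℝ}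

/-- Rates along a bounded path for any number above the noise level. -/
lemma IsGradientPath.limsup_le_of_noiseLevel_lt (hx : IsGradientPath f α w x)
    (hf : Differentiable ℝ f) (hα : StepSizes α) (hr : 0 < r) (hC : GradientBounds f C)
    (hb : BoundedPath x) (hL : LojasiewiczGradient f δ μ M) (hρ : 0 < ρ) {W : ℝ} (hW : 0 < W)
    (hwW : noiseLevel α r w < ENNReal.ofReal W) {μ' : ℝ} (hμ' : μ' = muHat f μ x ρ) :
    limsup (fun n => ENNReal.ofReal (gam α n ^ rateExp r μ' μ' * ‖gradient f (x n)‖ ^ 2)) atTop ≤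
      ENNReal.ofReal (rateConst r (CHat C x ρ) (MHat f M x ρ)) *
        phi r μ' (ENNReal.ofReal W) ^ μ' ∧
    limsup (fun n => ENNReal.ofReal (gam α n ^ rateExp r μ' μ' * |f (x n) - fHat f x|)) atTop ≤
      ENNReal.ofReal (rateConst r (CHat C x ρ) (MHat f M x ρ)) *
        phi r μ' (ENNReal.ofReal W) ^ μ' := by
  have hQ := hb.isCompact_qHat ρ
  have hmem : fHat f x ∈ f '' QHat x ρ :=
    Set.image_mono (hb.accSet_subset_qHat hρ.le) (hb.fHat_mem hf.continuous)
  obtain ⟨⟨hδ, -⟩, ⟨hμ1, hμ2⟩, hM1, hloja⟩ := hL _ hQ _ hmem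
  obtain ⟨hC1, -, hlip⟩ := hC _ hQ
  rw [muHat, if_pos hb] at hμ'
  rw [CHat, if_pos hb, MHat, if_pos hb]
  rw [← hμ'] at hμ1 hμ2 hloja
  set C₀ := C (QHat x ρ)
  set M₀ := M (QHat x ρ) (fHat f x)
  set δ₀ := δ (QHat x ρ) (fHat f x)
  have hμ0 : 0 < μ' := by linarith
  have hM0 : 0 < M₀ := by linarith
  have hlojaE : ∀ᶠ n in atTop, |f (x n) - fHat f x| ≤ δ₀ →
      |f (x n) - fHat f x| ≤ M₀ * ‖gradient f (x n)‖ ^ μ' :=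
    (hb.eventually_mem_qHat hρ).mono fun n hn => hloja _ hn
  obtain ⟨hu, hg⟩ := hx.tendsto_zero hf hα hr hC hb (hwW.trans ENNReal.ofReal_lt_top) hδ hM0 hμ0
    hlojaE
  have hsmall : Tendsto (fun n => 2 * (‖gradient f (x n)‖ + W * gam α n ^ (-r))) atTop (𝓝 0) := by
    simpa using (hg.add (tendsto_mul_gam_rpow_neg hα hr W)).const_mul 2
  -- Now gradient and noise are small: the relevant points lie within ρ/2 of the path, itself within
  -- ρ/2 of the accumulation set, so the constant of `QHat` applies.
  have hdesc := hx.eventualDescent hf hα hC1 hr hW hwW (by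
    filter_upwards [hsmall.eventually_lt_const (half_pos hρ),
      hb.eventually_infDist_le (half_pos hρ)] with n hn hd z hz
    refine hlip z ?_ (x n) ?_ <;> rw [hb.qHat_eq]
    · have := Metric.infDist_le_infDist_add_dist (s := accSet x) (x := z) (y := x n)
      rw [dist_eq_norm] at this
      exact (show Metric.infDist z (accSet x) ≤ ρ by linarith)
    · exact hd.trans (by linarith)) hlojaE
  obtain ⟨G, hG, hbar⟩ := exists_isBarrier_phi hr hC1 hM1 hμ1 hμ2 hδ hW
  set B := barrierConst r C₀ M₀ * (phi r μ' (ENNReal.ofReal W)).toReal ^ μ' with hB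
  have hc : 0 < 1 / (256 * C₀) := by positivity
  have hT : 0 ≤ 1 / (64 * C₀) := by positivity
  have hlow := hdesc.neg_barrier_le hbar hM0 hμ0 hc hT hδ (fun n => norm_nonneg _) hα.gam_mono
    hα.sum_infinite hu
  obtain ⟨s, hs⟩ := hdesc.exists_shift hbar hM0 hμ0 hc hT (fun n => norm_nonneg _) hα.gam_mono
    hα.sum_infinite hlow
    ((hu.eventually_lt_const (hbar.pos G le_rfl)).frequently.mono fun n hn => le_of_lt hn)
  have hK0 : 0 ≤ barrierConst r C₀ M₀ := by
    unfold barrierConst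
    positivity
  have hbound : ENNReal.ofReal (3584 * C₀ * B) ≤ ENNReal.ofReal (rateConst r C₀ M₀) *
      phi r μ' (ENNReal.ofReal W) ^ μ' := by
    rw [← ENNReal.ofReal_toReal (phi_ne_top (r := r) (μ := μ') (ENNReal.ofReal_ne_top (r := W))),
      ENNReal.ofReal_rpow_of_nonneg ENNReal.toReal_nonneg hμ0.le,
      ← ENNReal.ofReal_mul (zero_le_one.trans (show 1 ≤ rateConst r C₀ M₀ from le_max_left _ _)),
      hB, ← mul_assoc]
    refine ENNReal.ofReal_le_ofReal ?_
    gcongr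
    exact le_max_right _ _
  have hB0 : 0 ≤ B := by positivity
  constructor
  · refine (limsup_ofReal_rpow_mul_le (A := 3584 * C₀ * B) (s := s) hα.sum_infinite ?_).trans hbound
    -- Dividing 14 Φ by c = 1/(256 C₀) gives the factor 3584 = 14 · 256.
    filter_upwards [hs] with n hn
    have h1 := hn.2
    rw [one_div, inv_mul_le_iff₀ (by positivity)] at h1
    linarith
  · refine (limsup_ofReal_rpow_mul_le (A := 6 * B) (s := s) hα.sum_infinite ?_).trans
      ((ENNReal.ofReal_le_ofReal ?_).trans hbound)
    · filter_upwards [hs] with n hn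
      have h1 := hn.1
      linarith
    · gcongr
      linarith

/-- Rates for the gradients and the values along a bounded path. -/
lemma IsGradientPath.limsup_le (hx : IsGradientPath f α w x)
    (hf : Differentiable ℝ f) (hα : StepSizes α) (hr : 0 < r) (hC : GradientBounds f C)
    (hb : BoundedPath x) (hL : LojasiewiczGradient f δ μ M) (hρ : 0 < ρ)
    (hw : noiseLevel α r w < ∞) {μ' : ℝ} (hμ' : μ' = muHat f μ x ρ) :
    limsup (fun n => ENNReal.ofReal (gam α n ^ rateExp r μ' μ' * ‖gradient f (x n)‖ ^ 2)) atTop ≤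
      ENNReal.ofReal (rateConst r (CHat C x ρ) (MHat f M x ρ)) *
        phi r μ' (noiseLevel α r w) ^ μ' ∧
    limsup (fun n => ENNReal.ofReal (gam α n ^ rateExp r μ' μ' * |f (x n) - fHat f x|)) atTop ≤
      ENNReal.ofReal (rateConst r (CHat C x ρ) (MHat f M x ρ)) *
        phi r μ' (noiseLevel α r w) ^ μ' := by
  have hcont : Continuous fun v : ℝ≥0∞ =>
      ENNReal.ofReal (rateConst r (CHat C x ρ) (MHat f M x ρ)) * phi r μ' v ^ μ' :=
    (ENNReal.continuous_const_mul ENNReal.ofReal_ne_top).comp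
      (ENNReal.continuous_rpow_const.comp continuous_phi)
  -- The noise level may be 0, where the barrier could vanish, so it is approached strictly from
  -- above and `phi` is continuous there.
  have hne : (𝓝[>] noiseLevel α r w).NeBot := nhdsGT_neBot_of_exists_gt ⟨∞, hw⟩
  have hev : ∀ᶠ v in 𝓝[>] noiseLevel α r w,
      v ≠ ∞ ∧ noiseLevel α r w < v :=
    (show ∀ᶠ v in 𝓝[>] noiseLevel α r w, v ≠ ∞ from
      mem_nhdsWithin_of_mem_nhds (isOpen_ne.mem_nhds hw.ne)).and self_mem_nhdsWithin
  have hall := hev.mono fun v hv => by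
    have hv0 : 0 < v.toReal := ENNReal.toReal_pos (pos_of_gt hv.2).ne' hv.1
    have h := hx.limsup_le_of_noiseLevel_lt hf hα hr hC hb hL hρ hv0
      (by rw [ENNReal.ofReal_toReal hv.1]; exact hv.2) hμ'
    rw [ENNReal.ofReal_toReal hv.1] at h
    exact h
  exact ⟨ge_of_tendsto (hcont.tendsto _ |>.mono_left nhdsWithin_le_nhds)
      (hall.mono fun v hv => hv.1),
    ge_of_tendsto (hcont.tendsto _ |>.mono_left nhdsWithin_le_nhds) (hall.mono fun v hv => hv.2)⟩

/-- Rates for the distance to the stationary set along a bounded path. -/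
lemma IsGradientPath.limsup_infDist_le (hx : IsGradientPath f α w x)
    (hf : Differentiable ℝ f) (hα : StepSizes α) (hr : 0 < r) (hC : GradientBounds f C)
    (hb : BoundedPath x) (hL : LojasiewiczGradient f δ μ M) (hρ : 0 < ρ)
    (hw : noiseLevel α r w < ∞) {ν N : Set E → ℝ} (hS : LojasiewiczDistance f ν N) {μ' ν' : ℝ}
    (hμ' : μ' = muHat f μ x ρ) (hν' : ν' = nuHat f μ ν x ρ) :
    limsup (fun n => ENNReal.ofReal
        (gam α n ^ rateExp r ν' μ' * Metric.infDist (x n) (stationarySet f))) atTop ≤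
      ENNReal.ofReal (max 1 (NHat N x ρ * rateConst r (CHat C x ρ) (MHat f M x ρ))) *
        phi r μ' (noiseLevel α r w) ^ ν' := by
  obtain ⟨⟨hν0, hν1⟩, hN1, hdist⟩ := hS _ (hb.isCompact_qHat ρ)
  have hgrad := (hx.limsup_le hf hα hr hC hb hL hρ hw hμ').1
  rw [nuHat, if_pos hb] at hν'
  have hμν : ν' = μ' * (ν (QHat x ρ) / 2) := by rw [hν', hμ', muHat, if_pos hb]; ring
  rw [NHat, if_pos hb]
  set ν₀ := ν (QHat x ρ)
  set N₀ := N (QHat x ρ)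
  set K := rateConst r (CHat C x ρ) (MHat f M x ρ)
  have hK1 : 1 ≤ K := le_max_left _ _
  set w₀ := noiseLevel α r w
  have hν2 : 0 ≤ ν₀ / 2 := by positivity
  set T := fun v : ℝ≥0∞ => ENNReal.ofReal N₀ * v ^ (ν₀ / 2) with hTdef
  have hTmono : Monotone T := fun a b hab => by
    simp only [hTdef]
    gcongr
  have hTcont : Continuous T :=
    (ENNReal.continuous_const_mul ENNReal.ofReal_ne_top).comp ENNReal.continuous_rpow_const
  calc limsup (fun n => ENNReal.ofReal
        (gam α n ^ rateExp r ν' μ' * Metric.infDist (x n) (stationarySet f))) atTop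
      ≤ limsup (T ∘ fun n => ENNReal.ofReal
          (gam α n ^ rateExp r μ' μ' * ‖gradient f (x n)‖ ^ 2)) atTop := by
        refine limsup_le_limsup ?_
        filter_upwards [hb.eventually_mem_qHat hρ, hα.sum_infinite.eventually_gt_atTop 0]
          with n hn hγ
        have h1 := hdist _ hn
        simp only [hTdef, Function.comp]
        rw [ENNReal.ofReal_rpow_of_nonneg (by positivity) hν2, ← ENNReal.ofReal_mul (by linarith)]
        refine ENNReal.ofReal_le_ofReal ?_
        rw [Real.mul_rpow (by positivity) (by positivity), ← Real.rpow_mul hγ.le,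
          ← Real.rpow_natCast ‖gradient f (x n)‖, ← Real.rpow_mul (norm_nonneg _)]
        have e1 : rateExp r μ' μ' * (ν₀ / 2) = rateExp r ν' μ' := by
          rw [rateExp, rateExp, hμν]; ring
        have e2 : ((2 : ℕ) : ℝ) * (ν₀ / 2) = ν₀ := by push_cast; ring
        rw [e1, e2]
        calc gam α n ^ rateExp r ν' μ' * Metric.infDist (x n) (stationarySet f)
            ≤ gam α n ^ rateExp r ν' μ' * (N₀ * ‖gradient f (x n)‖ ^ ν₀) := by gcongr
          _ = N₀ * (gam α n ^ rateExp r ν' μ' * ‖gradient f (x n)‖ ^ ν₀) := by ring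
    _ = T (limsup (fun n => ENNReal.ofReal
          (gam α n ^ rateExp r μ' μ' * ‖gradient f (x n)‖ ^ 2)) atTop) :=
        (hTmono.map_limsup_of_continuousAt _ hTcont.continuousAt).symm
    _ ≤ T (ENNReal.ofReal K * phi r μ' w₀ ^ μ') := hTmono hgrad
    _ ≤ ENNReal.ofReal (max 1 (N₀ * K)) * phi r μ' w₀ ^ ν' := by
        simp only [hTdef]
        rw [ENNReal.mul_rpow_of_nonneg _ _ hν2, ← ENNReal.rpow_mul, ← hμν, ← mul_assoc]
        gcongr
        -- As K ≥ 1 and ν/2 ≤ 1, the power of K is at most K, which frees the constant from ν.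
        calc ENNReal.ofReal N₀ * ENNReal.ofReal K ^ (ν₀ / 2)
            ≤ ENNReal.ofReal N₀ * ENNReal.ofReal K ^ (1 : ℝ) := by
              gcongr
              · exact ENNReal.one_le_ofReal.2 hK1
              · linarith
          _ = ENNReal.ofReal (N₀ * K) := by
              rw [ENNReal.rpow_one, ENNReal.ofReal_mul (by linarith)]
          _ ≤ _ := ENNReal.ofReal_le_ofReal (le_max_right _ _)

end

end StochGrad

/-! ### The almost sure statement -/

open StochGrad
theorem mainTheorem1 (r : ℝ) (hr : 0 < r) :
    ∃ (K : ℝ → ℝ → ℝ) (L : ℝ → ℝ → ℝ → ℝ),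
      (∀ c m : ℝ, 1 ≤ K c m) ∧
      (∀ c m b : ℝ, 1 ≤ L c m b) ∧
      ∀ (d : ℕ) (f : EuclideanSpace ℝ (Fin d) → ℝ) (α : ℕ → ℝ)
        (Ω : Type u) (_ : MeasurableSpace Ω) (P : Measure Ω) (_ : IsProbabilityMeasure P)
        (θ w : ℕ → Ω → EuclideanSpace ℝ (Fin d))
        (C : Set (EuclideanSpace ℝ (Fin d)) → ℝ)
        (δ μ M : Set (EuclideanSpace ℝ (Fin d)) → ℝ → ℝ)
        (ρ : Ω → ℝ),
        Differentiable ℝ f →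
        GradientBounds f C →
        Measurable (θ 0) →
        (∀ n, Measurable (w n)) →
        (∀ n ω, θ (n + 1) ω = θ n ω - α n • (gradient f (θ n ω) + w n ω)) →
        StepSizes α →
        (∀ᵐ ω ∂P, BoundedPath (fun n => θ n ω) → noiseLevel α r (fun n => w n ω) < ∞) →
        LojasiewiczGradient f δ μ M →
        (∀ ω, 0 < ρ ω) →
        (∀ᵐ ω ∂P, BoundedPath (fun n => θ n ω) →
          let x : ℕ → EuclideanSpace ℝ (Fin d) := fun n => θ n ω
          let μ' := muHat f μ x (ρ ω)
          let p := rateExp r μ' μ'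
          let bound : ℝ≥0∞ := ENNReal.ofReal (K (CHat C x (ρ ω)) (MHat f M x (ρ ω))) *
            phi r μ' (noiseLevel α r (fun n => w n ω)) ^ μ'
          limsup (fun n => ENNReal.ofReal (gam α n ^ p * ‖gradient f (x n)‖ ^ 2)) atTop ≤ bound ∧
          limsup (fun n => ENNReal.ofReal (gam α n ^ p * |f (x n) - fHat f x|)) atTop ≤ bound) ∧
        ∀ (ν N : Set (EuclideanSpace ℝ (Fin d)) → ℝ), LojasiewiczDistance f ν N →
          ∀ᵐ ω ∂P, BoundedPath (fun n => θ n ω) →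
            let x : ℕ → EuclideanSpace ℝ (Fin d) := fun n => θ n ω
            let μ' := muHat f μ x (ρ ω)
            let ν' := nuHat f μ ν x (ρ ω)
            let q := rateExp r ν' μ'
            limsup (fun n => ENNReal.ofReal
                (gam α n ^ q * Metric.infDist (x n) (stationarySet f))) atTop ≤
              ENNReal.ofReal
                  (L (CHat C x (ρ ω)) (MHat f M x (ρ ω)) (NHat N x (ρ ω))) *
                phi r μ' (noiseLevel α r (fun n => w n ω)) ^ ν' := by
  refine ⟨rateConst r, fun c m b => max 1 (b * rateConst r c m), fun c m => le_max_left _ _,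
    fun c m b => le_max_left _ _, ?_⟩
  intro d f α Ω _ P _ θ w C δ μ M ρ hf hC _ _ hθ hα hw hL hρ
  refine ⟨?_, fun ν N hS => ?_⟩
  · filter_upwards [hw] with ω hω hb
    exact IsGradientPath.limsup_le (fun n => hθ n ω) hf hα hr hC hb hL (hρ ω) (hω hb) rfl
  · filter_upwards [hw] with ω hω hb
    exact IsGradientPath.limsup_infDist_le (fun n => hθ n ω) hf hα hr hC hb hL (hρ ω) (hω hb) hS
      rfl rfl
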